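/- **Conventions.** On $\mathbb R^n$ let $\|x\|=\max_i|x_i|$ be the uniform norm; lengths of curves, diameters, and distances are taken with respect to it (with $\operatorname{dist}(A,\emptyset)=+\infty$), and $\langle\cdot,\cdot\rangle$ is the standard inner product. A *domain* is a non-empty path connected open set $\Omega\subset\mathbb R^n$; $\partial\Omega$ is its boundary in $\mathbb R^n$. A *cube* is a closed non-degenerate cube $Q=Q(c_Q,r_Q)=\{y:\|y-c_Q\|\le r_Q\}$ with sides parallel to the axes. * The *intrinsic metric* $d_\Omega(x,y)$ is the infimum of the lengths of rectifiable curves in $\Omega$ joining $x$ to $y$. Let $(\Omega^*,\rho_\Omega)$ be the Cauchy completion of $(\Omega,d_\Omega)$, with $\Omega$ regarded as a subset of $\Omega^*$. The *split boundary* $\partial^*\Omega$ is the boundary of $\Omega$ in $(\Omega^*,\rho_\Omega)$. * $C^2(\Omega)$ is the space of functions $F:\Omega\to\mathbb R$ of class $C^2$ whose second order partial derivatives are bounded on $\Omega$, with the seminorm $\|F\|_{C^2(\Omega)}=\sum_{|\alpha|=2}\sup_\Omega|D^\alpha F|$. The *trace* of $F$ to the split boundary is the function $\operatorname{tr}_\Omega[F]$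 on $\partial^*\Omega$ with $\operatorname{tr}_\Omega[F](\omega)=\lim_{i\to\infty}F(y_i)$ for every $\omega\in\partial^*\Omega$ and every sequence $(y_i)$ in $\Omega$ converging to $\omega$ in $\Omega^*$. * A *Whitney covering* of $\Omega$ is a family $W_\Omega$ of cubes with pairwise disjoint interiors such that $\Omega=\bigcup\{Q:Q\in W_\Omega\}$ and $\operatorname{diam}Q\le\operatorname{dist}(Q,\partial\Omega)\le4\operatorname{diam}Q$ for every $Q\in W_\Omega$ (so $\Omega\ne\mathbb R^n$). * For each $Q\in W_\Omega$ let $a_Q$ be a point of $\partial\Omega$ nearest to $c_Q$, i.e. $\|a_Q-c_Q\|=\operatorname{dist}(c_Q,\partial\Omega)$. The points $a_Q+\frac1i(c_Q-a_Q)$, $i=1,2,\dots$, form a Cauchy sequence in $(\Omega,d_\Omega)$, and $\omega_Q\in\partial^*\Omega$ denotes its limit in $\Omega^*$. **Proposition.** For every $n$ there is a constant $\gamma=\gamma(n)>0$, depending only on $n$, with the following property. Let $\Omega\subset\mathbb R^n$ be a domain, let $W_\Omega$ be a Whitney covering of $\Omega$, let the points $a_Q$ ($Q\in W_\Omega$)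 be chosen as above, and let $f:\partial^*\Omega\to\mathbb R$ be continuous with respect to $\rho_\Omega$. Suppose that there exist a constant $\eta>0$ and a mapping $g:W_\Omega\to\mathbb R^n$ such that for every pair of cubes $Q,Q'\in W_\Omega$ with $Q\cap Q'\neq\emptyset$ $$|f(\omega_Q)-f(\omega_{Q'})-\langle g(Q'),a_Q-a_{Q'}\rangle|\le\eta\,(\operatorname{diam}Q+\operatorname{diam}Q')^2$$ and $$\|g(Q)-g(Q')\|\le\eta\,(\operatorname{diam}Q+\operatorname{diam}Q').$$ Then there exists a function $F\in C^2(\Omega)$ with $\|F\|_{C^2(\Omega)}\le\gamma\,\eta$ such that $\operatorname{tr}_\Omega[F]=f$. -/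

import Mathlib

open Set Filter Topology

/-!
Throughout, `ℝⁿ` is `Fin n → ℝ`; its norm, distance and diameters are those of the uniform norm
`‖x‖ = max |x_i|`.
-/

namespace SplitTrace

noncomputable section

/-- A domain in `ℝⁿ`: a non-empty path connected open set. -/
structure Domain (n : ℕ) where
  carrier : Set (Fin n → ℝ)
  isOpen : IsOpen carrier
  isPathConnected : IsPathConnected carrier

/-- A curve in the set `s` from `x` to `y`, parametrized by `[0, 1]`. -/
def IsCurveIn {n : ℕ} (s : Set (Fin n → ℝ)) (x y : Fin n → ℝ) (c : ℝ → Fin n → ℝ) : Prop :=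
  ContinuousOn c (Icc 0 1) ∧ MapsTo c (Icc 0 1) s ∧ c 0 = x ∧ c 1 = y

/-- The infimum of the lengths of the curves in `s` from `x` to `y`, as an extended number
(curves that are not rectifiable have length `∞` and do not contribute). -/
def curveDist {n : ℕ} (s : Set (Fin n → ℝ)) (x y : Fin n → ℝ) : ENNReal :=
  ⨅ (c : ℝ → Fin n → ℝ) (_ : IsCurveIn s x y c), eVariationOn c (Icc 0 1)

section CurveDist

variable {n : ℕ} {s : Set (Fin n → ℝ)} {x y z : Fin n → ℝ}

theorem curveDist_le {c : ℝ → Fin n → ℝ} (hc : IsCurveIn s x y c) :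
    curveDist s x y ≤ eVariationOn c (Icc 0 1) :=
  iInf₂_le c hc

theorem edist_le_curveDist : edist x y ≤ curveDist s x y := by
  refine le_iInf₂ fun c hc => ?_
  obtain ⟨-, -, h0, h1⟩ := hc
  have := eVariationOn.edist_le c (s := Icc (0 : ℝ) 1) (x := 0) (y := 1) (by simp) (by simp)
  rwa [h0, h1] at this

theorem curveDist_comm_le : curveDist s x y ≤ curveDist s y x := by
  refine le_iInf₂ fun c hc => ?_
  obtain ⟨hcont, hmaps, h0, h1⟩ := hc
  have hm : MapsTo (fun t : ℝ => 1 - t) (Icc 0 1) (Icc 0 1) := by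
    intro t ht
    simp only [mem_Icc] at ht ⊢
    constructor <;> linarith [ht.1, ht.2]
  have hanti : AntitoneOn (fun t : ℝ => 1 - t) (Icc 0 1) := by
    intro a _ b _ hab
    simp only
    linarith
  refine (curveDist_le (c := c ∘ fun t : ℝ => 1 - t) ?_).trans
    (eVariationOn.comp_le_of_antitoneOn c _ hanti hm)
  exact ⟨hcont.comp (by fun_prop) hm, hmaps.comp hm, by simp [h1], by simp [h0]⟩

theorem curveDist_triangle : curveDist s x z ≤ curveDist s x y + curveDist s y z := by
  unfold curveDist
  refine ENNReal.le_iInf₂_add_iInf₂ fun c hc d hd => ?_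
  obtain ⟨hc, hcs, hc0, hc1⟩ := hc
  obtain ⟨hd, hds, hd0, hd1⟩ := hd
  set e : ℝ → Fin n → ℝ := fun t => if t ≤ 1 / 2 then c (2 * t) else d (2 * t - 1) with he
  have hm1 : MapsTo (fun t : ℝ => 2 * t) (Icc 0 (1 / 2)) (Icc 0 1) := by
    intro t ht
    simp only [mem_Icc] at ht ⊢
    constructor <;> linarith [ht.1, ht.2]
  have hm2 : MapsTo (fun t : ℝ => 2 * t - 1) (Icc (1 / 2) 1) (Icc 0 1) := by
    intro t ht
    simp only [mem_Icc] at ht ⊢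
    constructor <;> linarith [ht.1, ht.2]
  have he1 : EqOn e (c ∘ fun t : ℝ => 2 * t) (Icc 0 (1 / 2)) := by
    intro t ht
    simp only [he, Function.comp]
    rw [if_pos ht.2]
  have he2 : EqOn e (d ∘ fun t : ℝ => 2 * t - 1) (Icc (1 / 2) 1) := by
    intro t ht
    simp only [he, Function.comp]
    split_ifs with h
    · have : t = 1 / 2 := le_antisymm h ht.1
      subst this
      norm_num [hc1, hd0]
    · rfl
  have hu : Icc (0 : ℝ) 1 = Icc 0 (1 / 2) ∪ Icc (1 / 2) 1 :=
    (Icc_union_Icc_eq_Icc (by norm_num) (by norm_num)).symm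
  have hmono1 : MonotoneOn (fun t : ℝ => 2 * t) (Icc 0 (1 / 2)) := by
    intro a _ b _ hab
    simp only
    linarith
  have hmono2 : MonotoneOn (fun t : ℝ => 2 * t - 1) (Icc (1 / 2) 1) := by
    intro a _ b _ hab
    simp only
    linarith
  have hcurve : IsCurveIn s x z e := by
    refine ⟨?_, ?_, ?_, ?_⟩
    · rw [hu]
      refine ContinuousOn.union_of_isClosed ?_ ?_ isClosed_Icc isClosed_Icc
      · exact (hc.comp (by fun_prop) hm1).congr he1
      · exact (hd.comp (by fun_prop) hm2).congr he2
    · intro t ht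
      rw [hu] at ht
      rcases ht with ht | ht
      · rw [he1 ht]
        exact hcs (hm1 ht)
      · rw [he2 ht]
        exact hds (hm2 ht)
    · rw [he1 (by norm_num)]
      simpa using hc0
    · rw [he2 (by norm_num)]
      norm_num [hd1]
  refine (iInf₂_le e hcurve).trans ?_
  have hg : IsGreatest (Icc (0 : ℝ) (1 / 2)) (1 / 2) := isGreatest_Icc (by norm_num)
  have hl : IsLeast (Icc (1 / 2 : ℝ) 1) (1 / 2) := isLeast_Icc (by norm_num)
  rw [hu, eVariationOn.union e hg hl, ← hu, eVariationOn.congr he1, eVariationOn.congr he2]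
  exact add_le_add (eVariationOn.comp_le_of_monotoneOn c _ hmono1 hm1)
    (eVariationOn.comp_le_of_monotoneOn d _ hmono2 hm2)

theorem curveDist_le_of_segment (h : segment ℝ x y ⊆ s) : curveDist s x y ≤ edist x y := by
  have hmaps : MapsTo (AffineMap.lineMap x y : ℝ → Fin n → ℝ) (Icc 0 1) s := by
    intro t ht
    apply h
    rw [segment_eq_image_lineMap]
    exact mem_image_of_mem _ ht
  have hL : LipschitzWith (nndist x y) (AffineMap.lineMap x y : ℝ → Fin n → ℝ) :=
    lipschitzWith_lineMap x y
  refine (curveDist_le (c := (AffineMap.lineMap x y : ℝ → Fin n → ℝ)) ?_).trans ?_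
  · exact ⟨hL.continuous.continuousOn, hmaps, by simp, by simp⟩
  · have h1 := (hL.lipschitzOnWith (s := univ)).comp_eVariationOn_le
      (g := (id : ℝ → ℝ)) (s := Icc 0 1) (fun _ _ => mem_univ _)
    have h2 : eVariationOn (id : ℝ → ℝ) (Icc 0 1) ≤ 1 := by
      have := (monotoneOn_id (s := Icc (0 : ℝ) 1)).eVariationOn_eq (a := 0) (b := 1)
        (by simp) (by simp)
      rw [inter_self] at this
      simp [this]
    calc eVariationOn (AffineMap.lineMap x y : ℝ → Fin n → ℝ) (Icc 0 1)
        ≤ (nndist x y : ENNReal) * eVariationOn (id : ℝ → ℝ) (Icc 0 1) := h1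
      _ ≤ (nndist x y : ENNReal) * 1 := by gcongr
      _ = edist x y := by rw [mul_one, edist_nndist]

theorem curveDist_lt_top (hs : IsOpen s) (hs' : IsPreconnected s) (hx : x ∈ s) (hy : y ∈ s) :
    curveDist s x y < ⊤ := by
  have key : ∀ u ∈ s, ∃ r > 0, Metric.ball u r ⊆ s ∧
      ∀ v ∈ Metric.ball u r, curveDist s u v < ⊤ ∧ curveDist s v u < ⊤ := by
    intro u hu
    obtain ⟨r, hr, hball⟩ := Metric.isOpen_iff.1 hs u hu
    refine ⟨r, hr, hball, fun v hv => ?_⟩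
    have h1 := curveDist_le_of_segment (s := s)
      (((convex_ball u r).segment_subset (Metric.mem_ball_self hr) hv).trans hball)
    have h2 := curveDist_le_of_segment (s := s)
      (((convex_ball u r).segment_subset hv (Metric.mem_ball_self hr)).trans hball)
    exact ⟨h1.trans_lt (edist_lt_top _ _), h2.trans_lt (edist_lt_top _ _)⟩
  by_contra hxy
  have hA : IsOpen {u | u ∈ s ∧ curveDist s x u < ⊤} := by
    refine Metric.isOpen_iff.2 fun u hu => ?_
    obtain ⟨r, hr, hb, hv⟩ := key u hu.1
    exact ⟨r, hr, fun v hvb => ⟨hb hvb,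
      curveDist_triangle.trans_lt (ENNReal.add_lt_top.2 ⟨hu.2, (hv v hvb).1⟩)⟩⟩
  have hB : IsOpen {u | u ∈ s ∧ ¬ curveDist s x u < ⊤} := by
    refine Metric.isOpen_iff.2 fun u hu => ?_
    obtain ⟨r, hr, hb, hv⟩ := key u hu.1
    refine ⟨r, hr, fun v hvb => ⟨hb hvb, fun hlt => hu.2 ?_⟩⟩
    exact curveDist_triangle.trans_lt (ENNReal.add_lt_top.2 ⟨hlt, (hv v hvb).2⟩)
  have hself : curveDist s x x < ⊤ := by
    obtain ⟨r, hr, -, hv⟩ := key x hx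
    exact (hv x (Metric.mem_ball_self hr)).1
  obtain ⟨u, -, hu1, hu2⟩ := hs' _ _ hA hB
    (fun u hu => (em (curveDist s x u < ⊤)).imp (fun h => ⟨hu, h⟩) (fun h => ⟨hu, h⟩))
    ⟨x, hx, hx, hself⟩ ⟨y, hy, hy, hxy⟩
  exact hu2.2 hu1.2

end CurveDist

namespace Domain

variable {n : ℕ} (Ω : Domain n)

/-- The points of the domain `Ω`; this type carries the intrinsic metric of `Ω` (not the metric
induced from `ℝⁿ`). -/
@[ext] structure Pt where
  val : Fin n → ℝ
  mem : val ∈ Ω.carrier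

/-- The intrinsic metric of `Ω`: the infimum of the lengths of the rectifiable curves in `Ω`
joining two points. (Cutting out loops does not increase length, so restricting to simple curves
gives the same infimum.) -/
instance instMetricSpacePt : MetricSpace Ω.Pt where
  dist x y := (curveDist Ω.carrier x.val y.val).toReal
  dist_self x := by
    have h : curveDist Ω.carrier x.val x.val ≤ edist x.val x.val :=
      curveDist_le_of_segment (by simpa using x.mem)
    rw [edist_self] at h
    simp [le_antisymm h bot_le]
  dist_comm x y := by
    rw [le_antisymm (curveDist_comm_le (s := Ω.carrier) (x := x.val) (y := y.val))
      curveDist_comm_le]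
  dist_triangle x y z := by
    have hc := Ω.isPathConnected.isConnected.isPreconnected
    have h1 := curveDist_lt_top Ω.isOpen hc x.mem y.mem
    have h2 := curveDist_lt_top Ω.isOpen hc y.mem z.mem
    rw [← ENNReal.toReal_add h1.ne h2.ne]
    exact ENNReal.toReal_mono (ENNReal.add_lt_top.2 ⟨h1, h2⟩).ne curveDist_triangle
  eq_of_dist_eq_zero {x y} h := by
    have hc := Ω.isPathConnected.isConnected.isPreconnected
    have h1 := curveDist_lt_top Ω.isOpen hc x.mem y.mem
    have h0 : curveDist Ω.carrier x.val y.val = 0 :=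
      ((ENNReal.toReal_eq_zero_iff _).1 h).resolve_right h1.ne
    have h2 := edist_le_curveDist (s := Ω.carrier) (x := x.val) (y := y.val)
    rw [h0] at h2
    exact Pt.ext (edist_le_zero.1 h2)

variable {Ω}

theorem dist_val_le (x y : Ω.Pt) : dist x.val y.val ≤ dist x y := by
  have h1 := curveDist_lt_top Ω.isOpen Ω.isPathConnected.isConnected.isPreconnected x.mem y.mem
  have h := ENNReal.toReal_mono h1.ne
    (edist_le_curveDist (s := Ω.carrier) (x := x.val) (y := y.val))
  rwa [← dist_edist] at h

theorem dist_le_of_segment (x y : Ω.Pt) (h : segment ℝ x.val y.val ⊆ Ω.carrier) :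
    dist x y ≤ dist x.val y.val := by
  have := ENNReal.toReal_mono (edist_ne_top _ _) (curveDist_le_of_segment h)
  rwa [← dist_edist] at this

variable (Ω)

/-- The Cauchy completion of `Ω` with respect to its intrinsic metric. -/
abbrev Completion : Type := UniformSpace.Completion Ω.Pt

/-- The split boundary of `Ω`: the boundary of `Ω`, as a subset of its Cauchy completion with
respect to the intrinsic metric. It is a metric space with the metric of the completion. -/
abbrev SplitBoundary : Type :=
  {ω : Ω.Completion // ω ∈ frontier (range fun x : Ω.Pt => (x : Ω.Completion))}

/-- `a` is a point of the boundary of `Ω` in `ℝⁿ` nearest to `c`. -/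
def IsNearest (c a : Fin n → ℝ) : Prop :=
  a ∈ frontier Ω.carrier ∧ dist a c = Metric.infDist c (frontier Ω.carrier)

variable {Ω}

theorem ball_subset {c : Fin n → ℝ} (hc : c ∈ Ω.carrier) :
    Metric.ball c (Metric.infDist c (frontier Ω.carrier)) ⊆ Ω.carrier := by
  intro z hz
  by_contra hzΩ
  have hr : 0 < Metric.infDist c (frontier Ω.carrier) := dist_nonneg.trans_lt hz
  have hpre : IsPreconnected (Metric.ball c (Metric.infDist c (frontier Ω.carrier))) :=
    (convex_ball _ _).isPreconnected
  have hdisj : ∀ u ∈ Metric.ball c (Metric.infDist c (frontier Ω.carrier)),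
      u ∉ frontier Ω.carrier := by
    intro u hu hu'
    have h1 := Metric.infDist_le_dist_of_mem (x := c) hu'
    rw [Metric.mem_ball, dist_comm] at hu
    linarith
  obtain ⟨u, -, hu1, hu2⟩ := hpre Ω.carrier (closure Ω.carrier)ᶜ Ω.isOpen
    isClosed_closure.isOpen_compl
    (fun u hu => by
      by_cases h : u ∈ Ω.carrier
      · exact Or.inl h
      · refine Or.inr fun hcl => hdisj u hu ?_
        rw [Ω.isOpen.frontier_eq]
        exact ⟨hcl, h⟩)
    ⟨c, Metric.mem_ball_self hr, hc⟩
    ⟨z, hz, fun hcl => hdisj z hz (by rw [Ω.isOpen.frontier_eq]; exact ⟨hcl, hzΩ⟩)⟩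
  exact hu2 (subset_closure hu1)

theorem ray_mem {c a : Fin n → ℝ} (hc : c ∈ Ω.carrier) (ha : Ω.IsNearest c a) {t : ℝ}
    (h0 : 0 < t) (h1 : t ≤ 1) : a + t • (c - a) ∈ Ω.carrier := by
  have hne : a ≠ c := by
    rintro rfl
    have := ha.1
    rw [Ω.isOpen.frontier_eq] at this
    exact this.2 hc
  apply ball_subset hc
  have hd : 0 < dist a c := dist_pos.2 hne
  have : a + t • (c - a) - c = (1 - t) • (a - c) := by
    ext i
    simp
    ring
  rw [Metric.mem_ball, ← ha.2, dist_eq_norm, this, norm_smul, Real.norm_of_nonneg (by linarith),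
    ← dist_eq_norm]
  nlinarith

/-- The points `a + (1 / i) (c - a)`, `i = 1, 2, …`, of `Ω`; the index is shifted by one. -/
def ray {c a : Fin n → ℝ} (hc : c ∈ Ω.carrier) (ha : Ω.IsNearest c a) (i : ℕ) : Ω.Pt where
  val := a + (1 / ((i : ℝ) + 1)) • (c - a)
  mem := ray_mem hc ha (by positivity) (by
    rw [div_le_one (by positivity)]
    linarith [(Nat.cast_nonneg i : (0 : ℝ) ≤ i)])

theorem cauchySeq_ray {c a : Fin n → ℝ} (hc : c ∈ Ω.carrier) (ha : Ω.IsNearest c a) :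
    CauchySeq (ray hc ha) := by
  have hval : Tendsto (fun i => (ray hc ha i).val) atTop (𝓝 a) := by
    have h := (tendsto_one_div_add_atTop_nhds_zero_nat (𝕜 := ℝ)).smul_const (c - a)
    simpa [ray] using h.const_add a
  have hC := hval.cauchySeq
  rw [Metric.cauchySeq_iff] at hC ⊢
  intro ε hε
  obtain ⟨N, hN⟩ := hC ε hε
  refine ⟨N, fun i hi j hj => (dist_le_of_segment _ _ ?_).trans_lt (hN i hi j hj)⟩
  have hconv : Convex ℝ ((fun t : ℝ => a + t • (c - a)) '' Ioc 0 1) := by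
    have : (fun t : ℝ => a + t • (c - a)) = (AffineMap.lineMap a c : ℝ →ᵃ[ℝ] (Fin n → ℝ)) := by
      ext t
      simp [AffineMap.lineMap_apply]
      ring
    rw [this]
    exact (convex_Ioc 0 1).affine_image _
  have hmem : ∀ k, (ray hc ha k).val ∈ (fun t : ℝ => a + t • (c - a)) '' Ioc 0 1 := by
    intro k
    refine ⟨1 / ((k : ℝ) + 1), ⟨by positivity, ?_⟩, rfl⟩
    rw [div_le_one (by positivity)]
    linarith [(Nat.cast_nonneg k : (0 : ℝ) ≤ k)]
  refine (hconv.segment_subset (hmem i) (hmem j)).trans ?_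
  rintro _ ⟨t, ht, rfl⟩
  exact ray_mem hc ha ht.1 ht.2

theorem exists_tendsto_ray {c a : Fin n → ℝ} (hc : c ∈ Ω.carrier) (ha : Ω.IsNearest c a) :
    ∃ ω : Ω.SplitBoundary,
      Tendsto (fun i => (ray hc ha i : Ω.Completion)) atTop (𝓝 (ω : Ω.Completion)) := by
  obtain ⟨ω, hω⟩ := cauchySeq_tendsto_of_complete
    ((UniformSpace.Completion.uniformContinuous_coe Ω.Pt).comp_cauchySeq (cauchySeq_ray hc ha))
  refine ⟨⟨ω, ?_, fun hint => ?_⟩, hω⟩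
  · exact mem_closure_of_tendsto hω (Eventually.of_forall fun i => ⟨ray hc ha i, rfl⟩)
  · obtain ⟨x, rfl⟩ := interior_subset hint
    have h1 : Tendsto (ray hc ha) atTop (𝓝 x) :=
      (UniformSpace.Completion.isUniformInducing_coe Ω.Pt).isInducing.tendsto_nhds_iff.2 hω
    have h2 : Tendsto (fun i => (ray hc ha i).val) atTop (𝓝 x.val) := by
      rw [tendsto_iff_dist_tendsto_zero] at h1 ⊢
      exact squeeze_zero (fun _ => dist_nonneg) (fun i => dist_val_le _ _) h1
    have h3 : Tendsto (fun i => (ray hc ha i).val) atTop (𝓝 a) := by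
      have h := (tendsto_one_div_add_atTop_nhds_zero_nat (𝕜 := ℝ)).smul_const (c - a)
      simpa [ray] using h.const_add a
    have hmem := ha.1
    rw [Ω.isOpen.frontier_eq, ← tendsto_nhds_unique h2 h3] at hmem
    exact hmem.2 x.mem

/-- The element of the split boundary represented by the Cauchy sequence
`a + (1 / i) (c - a)`, `i = 1, 2, …`, where `a` is a boundary point nearest to `c ∈ Ω`. -/
def rayEnd {c a : Fin n → ℝ} (hc : c ∈ Ω.carrier) (ha : Ω.IsNearest c a) : Ω.SplitBoundary :=
  (exists_tendsto_ray hc ha).choose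

theorem tendsto_ray {c a : Fin n → ℝ} (hc : c ∈ Ω.carrier) (ha : Ω.IsNearest c a) :
    Tendsto (fun i => (ray hc ha i : Ω.Completion)) atTop (𝓝 (rayEnd hc ha : Ω.Completion)) :=
  (exists_tendsto_ray hc ha).choose_spec

end Domain

/-- A (non-degenerate, closed) cube with sides parallel to the coordinate axes, given by its
center and half of its side length. -/
structure Cube (n : ℕ) where
  center : Fin n → ℝ
  radius : ℝ
  radius_pos : 0 < radius

/-- The set of points of a cube. -/
def Cube.toSet {n : ℕ} (Q : Cube n) : Set (Fin n → ℝ) := Metric.closedBall Q.center Q.radius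

/-- The diameter of a cube, in the uniform norm. -/
def Cube.diam {n : ℕ} (Q : Cube n) : ℝ := Metric.diam Q.toSet

/-- The distance between two sets, in the uniform norm; it is `∞` if one of them is empty. -/
def setDist {n : ℕ} (A B : Set (Fin n → ℝ)) : ENNReal := ⨅ (x ∈ A) (y ∈ B), edist x y

/-- A Whitney covering of `Ω`: a family of non-overlapping cubes with union `Ω` whose diameters
are comparable to their distances from the boundary. -/
structure WhitneyCovering {n : ℕ} (Ω : Domain n) where
  cubes : Set (Cube n)
  nonoverlapping : cubes.Pairwise fun Q Q' => Disjoint (interior Q.toSet) (interior Q'.toSet)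
  iUnion_eq : ⋃ Q ∈ cubes, Q.toSet = Ω.carrier
  diam_le : ∀ Q ∈ cubes, ENNReal.ofReal Q.diam ≤ setDist Q.toSet (frontier Ω.carrier)
  le_diam : ∀ Q ∈ cubes, setDist Q.toSet (frontier Ω.carrier) ≤ ENNReal.ofReal (4 * Q.diam)

theorem WhitneyCovering.center_mem {n : ℕ} {Ω : Domain n} (W : WhitneyCovering Ω)
    (Q : W.cubes) : Q.1.center ∈ Ω.carrier := by
  rw [← W.iUnion_eq]
  exact mem_biUnion Q.2 (Metric.mem_closedBall_self Q.1.radius_pos.le)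

/-- The element `ω_Q` of the split boundary assigned to a Whitney cube `Q` and a boundary point
`a` nearest to its center `c_Q`: the class of the sequence `a + (1 / i) (c_Q - a)`. -/
def WhitneyCovering.omega {n : ℕ} {Ω : Domain n} (W : WhitneyCovering Ω) (Q : W.cubes)
    {a : Fin n → ℝ} (ha : Ω.IsNearest Q.1.center a) : Ω.SplitBoundary :=
  Domain.rayEnd (W.center_mem Q) ha

/-- The partial derivative `∂F / ∂x_i`. -/
def partialDeriv {n : ℕ} (i : Fin n) (F : (Fin n → ℝ) → ℝ) (x : Fin n → ℝ) : ℝ :=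
  fderiv ℝ F x (Pi.single i 1)

/-- The homogeneous `C²` seminorm: the sum over all multi-indices `α` of order two, that is, over
all unordered pairs of indices `i ≤ j`, of the supremum of `|D^α F|` over `Ω`. -/
def c2Seminorm {n : ℕ} (Ω : Domain n) (F : (Fin n → ℝ) → ℝ) : ENNReal :=
  ∑ p : Fin n × Fin n with p.1 ≤ p.2,
    ⨆ x ∈ Ω.carrier, ENNReal.ofReal |partialDeriv p.1 (partialDeriv p.2 F) x|

/-- `F` belongs to the homogeneous space `C²(Ω)`: it is of class `C²` on `Ω` and its second order
partial derivatives are bounded on `Ω`. Values of `F` outside `Ω` are irrelevant. -/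
def MemC2 {n : ℕ} (Ω : Domain n) (F : (Fin n → ℝ) → ℝ) : Prop :=
  ContDiffOn ℝ 2 F Ω.carrier ∧ c2Seminorm Ω F < ⊤

/-- `f` is the trace of `F` to the split boundary: for every element `ω` of the split boundary and
every sequence `(y_k)` in `Ω` that represents it, `F(y_k)` converges to `f(ω)`. -/
def IsTrace {n : ℕ} (Ω : Domain n) (F : (Fin n → ℝ) → ℝ) (f : Ω.SplitBoundary → ℝ) : Prop :=
  ∀ (ω : Ω.SplitBoundary) (y : ℕ → Ω.Pt),
    Tendsto (fun k => (y k : Ω.Completion)) atTop (𝓝 (ω : Ω.Completion)) →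
      Tendsto (fun k => F (y k).val) atTop (𝓝 (f ω))

end

end SplitTrace

open SplitTrace

/-! The function is Whitney's: attach to each cube `Q` the affine function `P_Q` with value `f(ω_Q)`
at `a_Q` and gradient `g(Q)`, take bumps `φ_Q` equal to one on `Q` and supported in a slight
dilation of it, and put `F = (∑ φ_Q P_Q) / ∑ φ_Q`.

Second derivatives. Fix `x` in a cube `Q₀` and let `D` be its distance to the boundary. Since the
weights sum to one, `F - P_{Q₀}` is near `x` the weighted average of the differences `P_Q - P_{Q₀}`.
Only boundedly many cubes contribute, all of size comparable to `D` (`exists_card_near_le`), and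
each is joined to `Q₀` by a chain of touching cubes of bounded length (`exists_walk_touchGraph`).
Along one link the hypotheses say that the affine functions differ by `O(ηD²)` in value and `O(ηD)`
in gradient near `x`. Each derivative of a bump costs a factor `1/D`, so `F - P_{Q₀}` has size
`O(ηD²)`, first derivatives `O(ηD)` and second derivatives `O(η)` (`exists_jetBound_glue_sub`). As
`P_{Q₀}` is affine, the last bound holds for `F` itself. `JetBound` packs the three scaled bounds
into one number, so that sums, products and inverses are estimated once.

Trace. Let `y_k → ω` with `y_k ∈ Q_k`. Bounded second derivatives make the gradient of `F` Lipschitz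
for the intrinsic metric, hence bounded along `y_k`, and so `g(Q_k)` is bounded. The distance from
`y_k` to the boundary tends to zero (`tendsto_bdryDist`), which forces both `F(y_k) - f(ω_{Q_k}) →
0` and `ω_{Q_k} → ω` (`tendsto_omega`). Continuity of `f` concludes. -/

namespace SplitTrace

/-! ### Calculus of scaled second order jets -/

noncomputable section PartialDeriv

variable {n : ℕ} {h k : (Fin n → ℝ) → ℝ} {x : Fin n → ℝ}

theorem partialDeriv_congr (i : Fin n) (e : h =ᶠ[𝓝 x] k) :
    partialDeriv i h =ᶠ[𝓝 x] partialDeriv i k := by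
  filter_upwards [e.fderiv (𝕜 := ℝ)] with y hy
  simp [partialDeriv, hy]

theorem contDiffAt_partialDeriv (i : Fin n) (hh : ContDiffAt ℝ 2 h x) :
    ContDiffAt ℝ 1 (partialDeriv i h) x :=
  (hh.fderiv_right (m := 1) (by norm_num)).clm_apply contDiffAt_const

theorem eventually_differentiableAt (hh : ContDiffAt ℝ 2 h x) :
    ∀ᶠ y in 𝓝 x, DifferentiableAt ℝ h y := by
  filter_upwards [hh.eventually (by norm_num)] with y hy
  exact hy.differentiableAt (by norm_num)

theorem differentiableAt_partialDeriv (i : Fin n) (hh : ContDiffAt ℝ 2 h x) :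
    DifferentiableAt ℝ (partialDeriv i h) x :=
  (contDiffAt_partialDeriv i hh).differentiableAt (by norm_num)

theorem partialDeriv_add (i : Fin n) (hh : DifferentiableAt ℝ h x) (hk : DifferentiableAt ℝ k x) :
    partialDeriv i (h + k) x = partialDeriv i h x + partialDeriv i k x := by
  simp [partialDeriv, fderiv_add hh hk]

theorem partialDeriv_mul (i : Fin n) (hh : DifferentiableAt ℝ h x) (hk : DifferentiableAt ℝ k x) :
    partialDeriv i (h * k) x = h x * partialDeriv i k x + k x * partialDeriv i h x := by
  simp [partialDeriv, fderiv_mul hh hk]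

theorem partialDeriv_inv (i : Fin n) (hh : DifferentiableAt ℝ h x) (h0 : h x ≠ 0) :
    partialDeriv i h⁻¹ x = -(h⁻¹ x * h⁻¹ x * partialDeriv i h x) := by
  have : fderiv ℝ h⁻¹ x = _ := ((hasDerivAt_inv h0).comp_hasFDerivAt x hh.hasFDerivAt).fderiv
  simp only [partialDeriv, this, smul_apply, smul_eq_mul, Pi.inv_apply]
  field_simp

theorem partialDeriv_neg (i : Fin n) : partialDeriv i (-h) x = -partialDeriv i h x := by
  simp [partialDeriv, fderiv_neg]

theorem partialDeriv_partialDeriv_add (i j : Fin n) (hh : ContDiffAt ℝ 2 h x)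
    (hk : ContDiffAt ℝ 2 k x) :
    partialDeriv i (partialDeriv j (h + k)) x =
      partialDeriv i (partialDeriv j h) x + partialDeriv i (partialDeriv j k) x := by
  have e : partialDeriv j (h + k) =ᶠ[𝓝 x] partialDeriv j h + partialDeriv j k := by
    filter_upwards [eventually_differentiableAt hh, eventually_differentiableAt hk] with y h1 h2
    exact partialDeriv_add j h1 h2
  rw [(partialDeriv_congr i e).eq_of_nhds, partialDeriv_add i (differentiableAt_partialDeriv j hh)
    (differentiableAt_partialDeriv j hk)]

theorem partialDeriv_partialDeriv_mul (i j : Fin n) (hh : ContDiffAt ℝ 2 h x)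
    (hk : ContDiffAt ℝ 2 k x) :
    partialDeriv i (partialDeriv j (h * k)) x =
      h x * partialDeriv i (partialDeriv j k) x + partialDeriv j k x * partialDeriv i h x
      + (k x * partialDeriv i (partialDeriv j h) x + partialDeriv j h x * partialDeriv i k x) := by
  have e : partialDeriv j (h * k) =ᶠ[𝓝 x] h * partialDeriv j k + k * partialDeriv j h := by
    filter_upwards [eventually_differentiableAt hh, eventually_differentiableAt hk] with y h1 h2
    exact partialDeriv_mul j h1 h2
  have dh := hh.differentiableAt (by norm_num)
  have dk := hk.differentiableAt (by norm_num)
  have dh' := differentiableAt_partialDeriv j hh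
  have dk' := differentiableAt_partialDeriv j hk
  rw [(partialDeriv_congr i e).eq_of_nhds, partialDeriv_add i (dh.mul dk') (dk.mul dh'),
    partialDeriv_mul i dh dk', partialDeriv_mul i dk dh']

theorem partialDeriv_partialDeriv_inv (i j : Fin n) (hh : ContDiffAt ℝ 2 h x) (h0 : h x ≠ 0) :
    partialDeriv i (partialDeriv j h⁻¹) x =
      -(h⁻¹ x * h⁻¹ x * partialDeriv i (partialDeriv j h) x) +
        2 * (h⁻¹ x * h⁻¹ x * h⁻¹ x * (partialDeriv i h x * partialDeriv j h x)) := by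
  have e : partialDeriv j h⁻¹ =ᶠ[𝓝 x] -(h⁻¹ * h⁻¹ * partialDeriv j h) := by
    filter_upwards [eventually_differentiableAt hh, hh.continuousAt.eventually_ne h0] with y h1 h2
    exact partialDeriv_inv j h1 h2
  have dh := hh.differentiableAt (by norm_num)
  have di : DifferentiableAt ℝ h⁻¹ x := dh.inv h0
  have dh' := differentiableAt_partialDeriv j hh
  rw [(partialDeriv_congr i e).eq_of_nhds, partialDeriv_neg, partialDeriv_mul i (di.mul di) dh',
    partialDeriv_mul i di di, partialDeriv_inv i dh h0]
  simp only [Pi.mul_apply]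
  ring

/-- `h` is of class `C²` at `x`, and its value and its partial derivatives of orders one and two
there are at most `M`, `M / r` and `M / r²`. -/
structure JetBound (x : Fin n → ℝ) (r : ℝ) (h : (Fin n → ℝ) → ℝ) (M : ℝ) : Prop where
  contDiffAt : ContDiffAt ℝ 2 h x
  bound_zero : |h x| ≤ M
  bound_one : ∀ i, r * |partialDeriv i h x| ≤ M
  bound_two : ∀ i j, r ^ 2 * |partialDeriv i (partialDeriv j h) x| ≤ M

namespace JetBound

variable {r M M' : ℝ}

theorem nonneg (H : JetBound x r h M) : 0 ≤ M := (abs_nonneg _).trans H.bound_zero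

theorem mono (H : JetBound x r h M) (hM : M ≤ M') : JetBound x r h M' :=
  ⟨H.1, H.2.trans hM, fun i => (H.3 i).trans hM, fun i j => (H.4 i j).trans hM⟩

theorem congr (H : JetBound x r h M) (e : k =ᶠ[𝓝 x] h) : JetBound x r k M := by
  refine ⟨H.1.congr_of_eventuallyEq e, ?_, fun i => ?_, fun i j => ?_⟩
  · rw [e.eq_of_nhds]; exact H.2
  · rw [(partialDeriv_congr i e).eq_of_nhds]; exact H.3 i
  · rw [(partialDeriv_congr i (partialDeriv_congr j e)).eq_of_nhds]; exact H.4 i j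

theorem zero (x : Fin n → ℝ) (r : ℝ) : JetBound x r 0 0 := by
  have h1 : ∀ i : Fin n, partialDeriv i (0 : (Fin n → ℝ) → ℝ) = 0 := by
    intro i
    ext y
    simp [partialDeriv]
  refine ⟨contDiffAt_const, by simp, fun i => by simp [h1], fun i j => by simp [h1]⟩

theorem add (H : JetBound x r h M) (H' : JetBound x r k M') (hr : 0 < r) :
    JetBound x r (h + k) (M + M') := by
  refine ⟨H.1.add H'.1, (abs_add_le _ _).trans (add_le_add H.2 H'.2), fun i => ?_, fun i j => ?_⟩
  · rw [partialDeriv_add i (H.1.differentiableAt (by norm_num))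
      (H'.1.differentiableAt (by norm_num))]
    calc r * |partialDeriv i h x + partialDeriv i k x|
        ≤ r * (|partialDeriv i h x| + |partialDeriv i k x|) := by gcongr; exact abs_add_le _ _
      _ ≤ M + M' := by linarith [H.3 i, H'.3 i]
  · rw [partialDeriv_partialDeriv_add i j H.1 H'.1]
    calc r ^ 2 * |partialDeriv i (partialDeriv j h) x + partialDeriv i (partialDeriv j k) x|
        ≤ r ^ 2 * (|partialDeriv i (partialDeriv j h) x| + |partialDeriv i (partialDeriv j k) x|) :=
          by gcongr; exact abs_add_le _ _
      _ ≤ M + M' := by linarith [H.4 i j, H'.4 i j]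

theorem sum {ι : Type*} (s : Finset ι) {u : ι → (Fin n → ℝ) → ℝ} (hr : 0 < r)
    (H : ∀ q ∈ s, JetBound x r (u q) M) : JetBound x r (∑ q ∈ s, u q) (s.card * M) := by
  classical
  induction s using Finset.induction_on with
  | empty => simpa using zero x r
  | insert q s hq ih =>
    rw [Finset.sum_insert hq, Finset.card_insert_of_notMem hq]
    refine ((H q (by simp)).add (ih fun p hp => H p (by simp [hp])) hr).mono ?_
    push_cast
    linarith

/-- The weights `1`, `r`, `r²` are multiplicative along the Leibniz rule, so every term is at most
`M * M'`. The factor 4 counts the terms in a second derivative. -/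
theorem mul (H : JetBound x r h M) (H' : JetBound x r k M') (hr : 0 < r) :
    JetBound x r (h * k) (4 * (M * M')) := by
  have hM := H.nonneg
  have hM' := H'.nonneg
  have hMM : 0 ≤ M * M' := mul_nonneg hM hM'
  refine ⟨H.1.mul H'.1, ?_, fun i => ?_, fun i j => ?_⟩
  · rw [Pi.mul_apply, abs_mul]
    linarith [mul_le_mul H.2 H'.2 (abs_nonneg _) hM]
  · rw [partialDeriv_mul i (H.1.differentiableAt (by norm_num))
      (H'.1.differentiableAt (by norm_num))]
    calc r * |h x * partialDeriv i k x + k x * partialDeriv i h x|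
        ≤ r * (|h x| * |partialDeriv i k x| + |k x| * |partialDeriv i h x|) := by
          rw [← abs_mul, ← abs_mul]; gcongr; exact abs_add_le _ _
      _ = |h x| * (r * |partialDeriv i k x|) + (r * |partialDeriv i h x|) * |k x| := by ring
      _ ≤ M * M' + M * M' := add_le_add
          (mul_le_mul H.2 (H'.3 i) (by positivity) hM) (mul_le_mul (H.3 i) H'.2 (abs_nonneg _) hM)
      _ ≤ _ := by linarith
  · rw [partialDeriv_partialDeriv_mul i j H.1 H'.1]
    set a := partialDeriv i (partialDeriv j k) x
    set b := partialDeriv i (partialDeriv j h) x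
    calc r ^ 2 * |h x * a + partialDeriv j k x * partialDeriv i h x
            + (k x * b + partialDeriv j h x * partialDeriv i k x)|
        ≤ r ^ 2 * (|h x| * |a| + |partialDeriv j k x| * |partialDeriv i h x|
            + (|k x| * |b| + |partialDeriv j h x| * |partialDeriv i k x|)) := by
          simp only [← abs_mul]
          gcongr
          exact (abs_add_le _ _).trans (add_le_add (abs_add_le _ _) (abs_add_le _ _))
      _ = |h x| * (r ^ 2 * |a|) + (r * |partialDeriv i h x|) * (r * |partialDeriv j k x|)
            + ((r ^ 2 * |b|) * |k x| + (r * |partialDeriv j h x|) * (r * |partialDeriv i k x|)) := by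
          ring
      _ ≤ M * M' + M * M' + (M * M' + M * M') := add_le_add
          (add_le_add (mul_le_mul H.2 (H'.4 i j) (by positivity) hM)
            (mul_le_mul (H.3 i) (H'.3 j) (by positivity) hM))
          (add_le_add (mul_le_mul (H.4 i j) H'.2 (abs_nonneg _) hM)
            (mul_le_mul (H.3 j) (H'.3 i) (by positivity) hM))
      _ = _ := by ring

/-- Because `h x ≥ 1`, all powers of the inverse are at most one and `M ≥ 1`. The second derivative
`-h''/h² + 2h'h'/h³` then contributes `M + 2M² ≤ 3M²`. -/
theorem inv (H : JetBound x r h M) (hr : 0 < r) (h1 : 1 ≤ h x) :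
    JetBound x r h⁻¹ (3 * M ^ 2) := by
  have h0 : h x ≠ 0 := by linarith
  have hM : 1 ≤ M := h1.trans ((le_abs_self _).trans H.2)
  have hM2 : M ≤ M ^ 2 := by nlinarith
  have hi0 : 0 ≤ h⁻¹ x := by rw [Pi.inv_apply]; positivity
  have hi1 : h⁻¹ x ≤ 1 := by rw [Pi.inv_apply]; exact inv_le_one_of_one_le₀ h1
  have hi2 : h⁻¹ x * h⁻¹ x ≤ 1 := mul_le_one₀ hi1 hi0 hi1
  have hi3 : h⁻¹ x * h⁻¹ x * h⁻¹ x ≤ 1 := mul_le_one₀ hi2 hi0 hi1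
  refine ⟨H.1.inv h0, ?_, fun i => ?_, fun i j => ?_⟩
  · rw [abs_of_nonneg hi0]; linarith
  · rw [partialDeriv_inv i (H.1.differentiableAt (by norm_num)) h0, abs_neg, abs_mul,
      abs_of_nonneg (mul_nonneg hi0 hi0)]
    calc r * (h⁻¹ x * h⁻¹ x * |partialDeriv i h x|) ≤ r * (1 * |partialDeriv i h x|) := by gcongr
      _ ≤ 3 * M ^ 2 := by linarith [H.3 i]
  · rw [partialDeriv_partialDeriv_inv i j H.1 h0]
    set b := partialDeriv i (partialDeriv j h) x
    calc r ^ 2 * |-(h⁻¹ x * h⁻¹ x * b) +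
            2 * (h⁻¹ x * h⁻¹ x * h⁻¹ x * (partialDeriv i h x * partialDeriv j h x))|
        ≤ r ^ 2 * ((h⁻¹ x * h⁻¹ x) * |b| + 2 * ((h⁻¹ x * h⁻¹ x * h⁻¹ x) *
            (|partialDeriv i h x| * |partialDeriv j h x|))) := by
          gcongr
          refine (abs_add_le _ _).trans (le_of_eq ?_)
          rw [abs_neg, abs_mul, abs_mul 2, abs_mul (h⁻¹ x * h⁻¹ x * h⁻¹ x), abs_mul (partialDeriv i h x),
            abs_of_nonneg (mul_nonneg hi0 hi0),
            abs_of_nonneg (mul_nonneg (mul_nonneg hi0 hi0) hi0), abs_two]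
      _ ≤ r ^ 2 * (1 * |b| + 2 * (1 * (|partialDeriv i h x| * |partialDeriv j h x|))) := by gcongr
      _ = r ^ 2 * |b| + 2 * ((r * |partialDeriv i h x|) * (r * |partialDeriv j h x|)) := by ring
      _ ≤ M ^ 2 + 2 * (M * M) := add_le_add ((H.4 i j).trans hM2)
          (mul_le_mul_of_nonneg_left (mul_le_mul (H.3 i) (H.3 j) (by positivity) (by linarith))
            (by norm_num))
      _ = _ := by ring

end JetBound

/-- The affine function with value `b` at `a` and gradient `v`. -/
def affineJet (b : ℝ) (v a : Fin n → ℝ) (x : Fin n → ℝ) : ℝ := b + v ⬝ᵥ (x - a)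

theorem hasFDerivAt_affineJet (b : ℝ) (v a x : Fin n → ℝ) :
    HasFDerivAt (affineJet b v a)
      (∑ i, v i • (ContinuousLinearMap.proj i : (Fin n → ℝ) →L[ℝ] ℝ)) x := by
  have : affineJet b v a = fun x => b + ∑ i, v i * (x i - a i) := by
    ext x; simp [affineJet, dotProduct]
  rw [this]
  refine (HasFDerivAt.fun_sum fun i _ => ?_).const_add b
  exact (((ContinuousLinearMap.proj i : (Fin n → ℝ) →L[ℝ] ℝ).hasFDerivAt).sub_const _).const_mul _

theorem partialDeriv_affineJet (i : Fin n) (b : ℝ) (v a : Fin n → ℝ) :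
    partialDeriv i (affineJet b v a) = fun _ => v i := by
  ext x
  simp [partialDeriv, (hasFDerivAt_affineJet b v a x).fderiv, Pi.single_apply]

theorem contDiff_affineJet (b : ℝ) (v a : Fin n → ℝ) : ContDiff ℝ 2 (affineJet b v a) := by
  have : affineJet b v a = fun x => b + ∑ i, v i * (x i - a i) := by
    ext x; simp [affineJet, dotProduct]
  rw [this]
  fun_prop

theorem abs_dotProduct_le (v w : Fin n → ℝ) : |v ⬝ᵥ w| ≤ n * (‖v‖ * ‖w‖) := by
  calc |v ⬝ᵥ w| ≤ ∑ i, |v i * w i| := Finset.abs_sum_le_sum_abs _ _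
    _ ≤ ∑ _i : Fin n, ‖v‖ * ‖w‖ := Finset.sum_le_sum fun i _ => by
        rw [abs_mul]
        exact mul_le_mul (norm_le_pi_norm v i) (norm_le_pi_norm w i) (abs_nonneg _) (norm_nonneg _)
    _ = _ := by simp

/-- Recentring the difference at `a` makes its value and its gradient there exactly the two
quantities bounded in the Whitney condition. -/
theorem affineJet_sub (b b' : ℝ) (v v' a a' : Fin n → ℝ) :
    affineJet b v a - affineJet b' v' a' =
      affineJet (b - b' - v' ⬝ᵥ (a - a')) (v - v') a := by
  ext x
  simp only [affineJet, Pi.sub_apply, sub_dotProduct, dotProduct_sub]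
  ring

theorem JetBound.affineJet {b : ℝ} {v a x : Fin n → ℝ} {r M₀ M₁ : ℝ} (hr : 0 < r)
    (hb : |b| ≤ M₀) (hv : ‖v‖ ≤ M₁) {M : ℝ} (hM : M₀ + n * (M₁ * ‖x - a‖) ≤ M) (hM' : r * M₁ ≤ M) :
    JetBound x r (affineJet b v a) M := by
  have hM₁ : 0 ≤ M₁ := (norm_nonneg _).trans hv
  refine ⟨(contDiff_affineJet b v a).contDiffAt, ?_, fun i => ?_, fun i j => ?_⟩
  · refine (abs_add_le _ _).trans (le_trans (add_le_add hb ((abs_dotProduct_le _ _).trans ?_)) hM)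
    gcongr
  · rw [partialDeriv_affineJet]
    refine le_trans ?_ hM'
    gcongr
    exact (norm_le_pi_norm v i).trans hv
  · rw [partialDeriv_affineJet]
    simp only [partialDeriv, fderiv_fun_const, Pi.zero_apply, zero_apply, abs_zero, mul_zero]
    exact le_trans (by positivity) hM'

theorem partialDeriv_comp_smul_sub (i : Fin n) (ψ : (Fin n → ℝ) → ℝ) (c : Fin n → ℝ) (s : ℝ) :
    partialDeriv i (fun x => ψ (s • (x - c))) = fun x => s * partialDeriv i ψ (s • (x - c)) := by
  ext x
  have := fderiv_comp_sub (𝕜 := ℝ) (f := fun x => ψ (s • x)) (x := x) c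
  simp only [partialDeriv, this, fderiv_comp_smul]
  simp

theorem exists_bound_partialDeriv {ψ : (Fin n → ℝ) → ℝ} (hψ : ContDiff ℝ 2 ψ)
    (hc : HasCompactSupport ψ) :
    ∃ K : ℝ, 1 ≤ K ∧ ∀ x, JetBound x 1 ψ K := by
  have hc1 : ∀ i, HasCompactSupport (partialDeriv i ψ) := fun i => hc.fderiv_apply (𝕜 := ℝ) _
  have hd1 : ∀ i, ContDiff ℝ 1 (partialDeriv i ψ) := fun i =>
    (hψ.fderiv_right (m := 1) (by norm_num)).clm_apply contDiff_const
  have hc2 : ∀ i j, HasCompactSupport (partialDeriv i (partialDeriv j ψ)) := fun i j =>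
    (hc1 j).fderiv_apply (𝕜 := ℝ) _
  have hd2 : ∀ i j, Continuous (partialDeriv i (partialDeriv j ψ)) := fun i j =>
    ((hd1 j).continuous_fderiv (by norm_num)).clm_apply continuous_const
  obtain ⟨A, hA⟩ := hc.exists_bound_of_continuous hψ.continuous
  choose B hB using fun i => (hc1 i).exists_bound_of_continuous (hd1 i).continuous
  choose C hC using fun i j => (hc2 i j).exists_bound_of_continuous (hd2 i j)
  have hB0 : ∀ i, 0 ≤ B i := fun i => (norm_nonneg _).trans (hB i 0)
  have hC0 : ∀ i j, 0 ≤ C i j := fun i j => (norm_nonneg _).trans (hC i j 0)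
  have hA0 : 0 ≤ A := (norm_nonneg _).trans (hA 0)
  have hBs : 0 ≤ ∑ i, B i := Finset.sum_nonneg fun i _ => hB0 i
  have hCs : 0 ≤ ∑ i, ∑ j, C i j := Finset.sum_nonneg fun i _ => Finset.sum_nonneg fun j _ => hC0 i j
  refine ⟨1 + A + ∑ i, B i + ∑ i, ∑ j, C i j, by linarith, fun x => ⟨hψ.contDiffAt, ?_, ?_, ?_⟩⟩
  · have := hA x
    rw [Real.norm_eq_abs] at this
    linarith
  · intro i
    have := hB i x
    rw [Real.norm_eq_abs] at this
    have h2 := Finset.single_le_sum (f := B) (fun i _ => hB0 i) (Finset.mem_univ i)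
    linarith
  · intro i j
    have := hC i j x
    rw [Real.norm_eq_abs] at this
    have h2 := Finset.single_le_sum (f := C i) (fun j _ => hC0 i j) (Finset.mem_univ j)
    have h3 := Finset.single_le_sum (f := fun i => ∑ j, C i j)
      (fun i _ => Finset.sum_nonneg fun j _ => hC0 i j) (Finset.mem_univ i)
    linarith

/-- Each derivative of the rescaled function brings out a factor `s`, and `r * s ≤ T` absorbs it
into the weight; two derivatives cost at most `T ^ 2`. -/
theorem JetBound.comp_smul_sub {ψ : (Fin n → ℝ) → ℝ} {K : ℝ} (hψ : ∀ x, JetBound x 1 ψ K)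
    (c : Fin n → ℝ) {s r T : ℝ} (hs : 0 ≤ s) (hr : 0 < r) (hT : 1 ≤ T) (hsr : r * s ≤ T)
    (x : Fin n → ℝ) : JetBound x r (fun x => ψ (s • (x - c))) (T ^ 2 * K) := by
  have hK : 0 ≤ K := (hψ 0).nonneg
  have hT2 : T ≤ T ^ 2 := by nlinarith
  refine ⟨?_, ?_, fun i => ?_, fun i j => ?_⟩
  · have h1 : ContDiffAt ℝ 2 (fun x : Fin n → ℝ => s • (x - c)) x := by fun_prop
    exact ContDiffAt.comp x (hψ (s • (x - c))).1 h1
  · have := (hψ (s • (x - c))).2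
    nlinarith
  · rw [partialDeriv_comp_smul_sub, abs_mul, abs_of_nonneg hs, ← mul_assoc]
    have := (hψ (s • (x - c))).3 i
    rw [one_mul] at this
    exact mul_le_mul (hsr.trans hT2) this (abs_nonneg _) (by positivity)
  · have h2 : partialDeriv i (fun x => s * partialDeriv j ψ (s • (x - c))) x =
        s * partialDeriv i (fun x => partialDeriv j ψ (s • (x - c))) x := by
      have hd : DifferentiableAt ℝ (fun x => partialDeriv j ψ (s • (x - c))) x :=
        DifferentiableAt.comp x (differentiableAt_partialDeriv j (hψ (s • (x - c))).1)
          (f := fun x : Fin n → ℝ => s • (x - c)) (by fun_prop)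
      rw [partialDeriv, fderiv_const_mul hd]
      simp [partialDeriv]
    rw [partialDeriv_comp_smul_sub, h2, partialDeriv_comp_smul_sub, abs_mul, abs_mul,
      abs_of_nonneg hs]
    have := (hψ (s • (x - c))).4 i j
    rw [one_pow, one_mul] at this
    calc r ^ 2 * (s * (s * |partialDeriv i (partialDeriv j ψ) (s • (x - c))|))
        = (r * s) ^ 2 * |partialDeriv i (partialDeriv j ψ) (s • (x - c))| := by ring
      _ ≤ T ^ 2 * K := by gcongr

/-- A smooth bump function equal to one on the unit ball and supported in the ball of
radius `5 / 4` of the uniform norm. -/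
def unitBump (n : ℕ) : ContDiffBump (0 : Fin n → ℝ) := ⟨1, 5 / 4, by norm_num, by norm_num⟩

end PartialDeriv

end SplitTrace

namespace SplitTrace

/-! ### Geometry of Whitney cubes: sizes, bounded overlap, chains -/

noncomputable section WhitneyGeometry

variable {n : ℕ}

theorem Cube.center_mem_toSet (Q : Cube n) : Q.center ∈ Q.toSet :=
  Metric.mem_closedBall_self Q.radius_pos.le

theorem Cube.diam_eq [NeZero n] (Q : Cube n) : Q.diam = 2 * Q.radius := by
  have : Nonempty (Fin n) := ⟨0⟩
  rw [Cube.diam, Cube.toSet, Metric.diam_closedBall_eq]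
  · exact Q.radius_pos.le

/-- The distance to the boundary of a domain. -/
def Domain.bdryDist (Ω : Domain n) (x : Fin n → ℝ) : ℝ := Metric.infDist x (frontier Ω.carrier)

theorem Domain.bdryDist_le_add (Ω : Domain n) (x y : Fin n → ℝ) :
    Ω.bdryDist x ≤ Ω.bdryDist y + dist x y := Metric.infDist_le_infDist_add_dist

theorem Domain.ball_bdryDist_subset {Ω : Domain n} {x : Fin n → ℝ} (hx : x ∈ Ω.carrier) :
    Metric.ball x (Ω.bdryDist x) ⊆ Ω.carrier := Domain.ball_subset hx

/-- Finite cardinality bound for separated subsets of a ball of the uniform norm. -/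
theorem exists_card_le_of_separated (n : ℕ) (R : ℝ) :
    ∃ N : ℕ, ∀ (x : Fin n → ℝ) (D : ℝ), 0 < D → ∀ s : Finset (Fin n → ℝ),
      (∀ c ∈ s, dist c x ≤ R * D) → (∀ c ∈ s, ∀ d ∈ s, c ≠ d → D ≤ dist c d) → s.card ≤ N := by
  classical
  -- After rescaling by `D⁻¹` the points are 1-separated, so each ball of radius `1/2` of a fixed
  -- finite cover holds at most one of them.
  obtain ⟨t, -, ht, hcov⟩ := finite_cover_balls_of_compact
    (isCompact_closedBall (0 : Fin n → ℝ) R) (show (0 : ℝ) < 1 / 2 by norm_num)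
  refine ⟨ht.toFinset.card, fun x D hD s hs hsep => ?_⟩
  have key : ∀ c ∈ s, ∃ p ∈ t, dist (D⁻¹ • (c - x)) p < 1 / 2 := by
    intro c hc
    have : D⁻¹ • (c - x) ∈ Metric.closedBall (0 : Fin n → ℝ) R := by
      rw [mem_closedBall_zero_iff, norm_smul, Real.norm_of_nonneg (by positivity), ← dist_eq_norm,
        inv_mul_le_iff₀ hD, mul_comm]
      exact hs c hc
    simpa using hcov this
  choose! p hp hdist using key
  refine Finset.card_le_card_of_injOn p (fun c hc => by simpa using hp c hc) ?_
  intro c hc d hd hcd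
  by_contra hne
  have h1 := hsep c hc d hd hne
  have h2 : dist (D⁻¹ • (c - x)) (D⁻¹ • (d - x)) < 1 := by
    have h3 := hdist d hd
    rw [← hcd, dist_comm] at h3
    have := dist_triangle (D⁻¹ • (c - x)) (p c) (D⁻¹ • (d - x))
    linarith [hdist c hc]
  rw [dist_smul₀, Real.norm_of_nonneg (by positivity), dist_sub_right, inv_mul_lt_iff₀ hD] at h2
  linarith

/-- Otherwise a point of the segment between the centers would lie in both open cubes. -/
theorem Cube.radius_add_le_dist {Q Q' : Cube n}
    (h : Disjoint (interior Q.toSet) (interior Q'.toSet)) :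
    Q.radius + Q'.radius ≤ dist Q.center Q'.center := by
  by_contra! hlt
  have h1 := Metric.ball_subset_interior_closedBall (x := Q.center) (ε := Q.radius)
  have h2 := Metric.ball_subset_interior_closedBall (x := Q'.center) (ε := Q'.radius)
  obtain ⟨z, hz1, hz2⟩ := exists_dist_lt_lt (x := Q.center) (z := Q'.center) Q.radius_pos
    Q'.radius_pos (by linarith)
  refine Set.disjoint_left.1 h (h1 (Metric.mem_ball.2 ?_)) (h2 (Metric.mem_ball.2 hz2))
  rwa [dist_comm]

namespace WhitneyCovering

variable {Ω : Domain n}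

theorem toSet_subset (W : WhitneyCovering Ω) (Q : W.cubes) : Q.1.toSet ⊆ Ω.carrier := by
  rw [← W.iUnion_eq]
  exact subset_biUnion_of_mem (u := fun Q : Cube n => Q.toSet) Q.2

theorem exists_mem (W : WhitneyCovering Ω) {x : Fin n → ℝ} (hx : x ∈ Ω.carrier) : ∃ Q : W.cubes, x ∈ Q.1.toSet := by
  rw [← W.iUnion_eq] at hx
  obtain ⟨Q, hQ, hxQ⟩ := mem_iUnion₂.1 hx
  exact ⟨⟨Q, hQ⟩, hxQ⟩

theorem frontier_nonempty (W : WhitneyCovering Ω) : (frontier Ω.carrier).Nonempty := by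
  obtain ⟨x, hx⟩ := Ω.isPathConnected.nonempty
  obtain ⟨Q, -⟩ := W.exists_mem hx
  by_contra h
  rw [not_nonempty_iff_eq_empty] at h
  have := W.le_diam Q.1 Q.2
  simp only [setDist, h, mem_empty_iff_false, iInf_false, iInf_top, top_le_iff] at this
  exact ENNReal.ofReal_ne_top this

/-- A non-empty subset of a one-point space has no boundary. Positive dimension is what makes the
diameter of a cube equal to twice its radius. -/
theorem dimension_ne_zero (W : WhitneyCovering Ω) : NeZero n := by
  refine ⟨?_⟩
  rintro rfl
  obtain ⟨x, hx⟩ := W.frontier_nonempty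
  have h1 := Ω.isOpen.frontier_eq ▸ hx
  obtain ⟨y, hy⟩ := Ω.isPathConnected.nonempty
  exact h1.2 (Subsingleton.elim y x ▸ hy)

theorem two_radius_le (W : WhitneyCovering Ω) {Q : W.cubes} {x : Fin n → ℝ} (hx : x ∈ Q.1.toSet) :
    2 * Q.1.radius ≤ Ω.bdryDist x := by
  have := W.dimension_ne_zero
  refine (Metric.le_infDist W.frontier_nonempty).2 fun y hy => ?_
  have h1 := (W.diam_le Q.1 Q.2).trans (iInf₂_le_of_le x hx (iInf₂_le y hy))
  rw [edist_dist, ENNReal.ofReal_le_ofReal_iff dist_nonneg, Cube.diam_eq] at h1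
  exact h1

/-- The constant is `8 + 2`: the distance of the cube to the boundary is at most four diameters, and
moving within the cube costs one more. -/
theorem bdryDist_le (W : WhitneyCovering Ω) {Q : W.cubes} {x : Fin n → ℝ} (hx : x ∈ Q.1.toSet) :
    Ω.bdryDist x ≤ 10 * Q.1.radius := by
  have := W.dimension_ne_zero
  have hr := Q.1.radius_pos
  have h1 : ENNReal.ofReal (Ω.bdryDist x - 2 * Q.1.radius) ≤
      setDist Q.1.toSet (frontier Ω.carrier) := by
    refine le_iInf₂ fun z hz => le_iInf₂ fun y hy => ?_
    rw [edist_dist]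
    apply ENNReal.ofReal_le_ofReal
    have h2 := Ω.bdryDist_le_add x z
    have h3 : Ω.bdryDist z ≤ dist z y := Metric.infDist_le_dist_of_mem hy
    have h4 := dist_triangle_right x z Q.1.center
    have h5 : dist x Q.1.center ≤ Q.1.radius := hx
    have h6 : dist z Q.1.center ≤ Q.1.radius := hz
    linarith
  have h2 := h1.trans (W.le_diam Q.1 Q.2)
  rw [Cube.diam_eq, ENNReal.ofReal_le_ofReal_iff (by positivity)] at h2
  linarith

theorem bdryDist_pos (W : WhitneyCovering Ω) {x : Fin n → ℝ} (hx : x ∈ Ω.carrier) :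
    0 < Ω.bdryDist x := by
  obtain ⟨Q, hQ⟩ := W.exists_mem hx
  linarith [W.two_radius_le hQ, Q.1.radius_pos]

/-- The Whitney cubes close to the point `x`. -/
def near (W : WhitneyCovering Ω) (x : Fin n → ℝ) : Set W.cubes :=
  {Q | (Q.1.toSet ∩ Metric.closedBall x (Ω.bdryDist x / 4)).Nonempty}

variable {W : WhitneyCovering Ω} {x : Fin n → ℝ}

theorem mem_near_of_mem (hx : x ∈ Ω.carrier) {Q : W.cubes} (hQ : x ∈ Q.1.toSet) : Q ∈ W.near x :=
  ⟨x, hQ, Metric.mem_closedBall_self (by linarith [W.bdryDist_pos hx])⟩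

/-- A point of `Q` within a quarter of `Ω.bdryDist x` of `x` has boundary distance between `3/4` and
`5/4` of that of `x`; this gives the constants here and in the next two lemmas. -/
theorem radius_le_of_mem_near {Q : W.cubes} (hQ : Q ∈ W.near x) :
    Q.1.radius ≤ 5 / 8 * Ω.bdryDist x := by
  obtain ⟨y, hy, hyx⟩ := hQ
  rw [Metric.mem_closedBall] at hyx
  linarith [W.two_radius_le hy, Ω.bdryDist_le_add y x]

theorem le_radius_of_mem_near {Q : W.cubes} (hQ : Q ∈ W.near x) :
    3 / 40 * Ω.bdryDist x ≤ Q.1.radius := by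
  obtain ⟨y, hy, hyx⟩ := hQ
  rw [Metric.mem_closedBall, dist_comm] at hyx
  linarith [W.bdryDist_le hy, Ω.bdryDist_le_add x y]

theorem dist_center_le_of_mem_near {Q : W.cubes} (hQ : Q ∈ W.near x) :
    dist Q.1.center x ≤ 7 / 8 * Ω.bdryDist x := by
  have h := radius_le_of_mem_near hQ
  obtain ⟨y, hy, hyx⟩ := hQ
  rw [Metric.mem_closedBall] at hyx
  have hy' : dist y Q.1.center ≤ Q.1.radius := hy
  rw [dist_comm] at hy'
  linarith [dist_triangle Q.1.center y x]

theorem exists_card_near_le (n : ℕ) : ∃ N : ℕ, ∀ (Ω : Domain n) (W : WhitneyCovering Ω)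
    (x : Fin n → ℝ), x ∈ Ω.carrier → (W.near x).Finite ∧ (W.near x).ncard ≤ N := by
  classical
  -- The centers are `3/20 * D` apart and within `7/8 * D` of `x`, where `D` is the boundary
  -- distance of `x`; and `7/8 ≤ 6 * (3/20)`.
  obtain ⟨N, hN⟩ := exists_card_le_of_separated n 6
  refine ⟨N, fun Ω W x hx => ?_⟩
  have hD := W.bdryDist_pos hx
  have hsep : ∀ Q ∈ W.near x, ∀ Q' ∈ W.near x, Q ≠ Q' →
      3 / 20 * Ω.bdryDist x ≤ dist Q.1.center Q'.1.center := by
    intro Q hQ Q' hQ' hne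
    have h1 := Cube.radius_add_le_dist
      (W.nonoverlapping Q.2 Q'.2 (fun h => hne (Subtype.ext h)))
    linarith [le_radius_of_mem_near hQ, le_radius_of_mem_near hQ']
  have hfin : ∀ s : Finset W.cubes, (s : Set W.cubes) ⊆ W.near x → s.card ≤ N := by
    intro s hs
    have hinj : Set.InjOn (fun Q : W.cubes => Q.1.center) s := by
      intro Q hQ Q' hQ' h
      by_contra hne
      have := hsep Q (hs hQ) Q' (hs hQ') hne
      simp only at h
      rw [h, dist_self] at this
      linarith
    rw [← Finset.card_image_of_injOn hinj]
    refine hN x (3 / 20 * Ω.bdryDist x) (by positivity) _ ?_ ?_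
    · intro c hc
      obtain ⟨Q, hQ, rfl⟩ := Finset.mem_image.1 hc
      linarith [dist_center_le_of_mem_near (hs hQ)]
    · intro c hc d hd hcd
      obtain ⟨Q, hQ, rfl⟩ := Finset.mem_image.1 hc
      obtain ⟨Q', hQ', rfl⟩ := Finset.mem_image.1 hd
      exact hsep Q (hs hQ) Q' (hs hQ') (fun h => hcd (h ▸ rfl))
  have hF : (W.near x).Finite := by
    by_contra hinf
    obtain ⟨t, ht, hcard⟩ := Set.Infinite.exists_subset_card_eq hinf (N + 1)
    have := hfin t ht
    omega
  refine ⟨hF, ?_⟩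
  rw [Set.ncard_eq_toFinset_card _ hF]
  exact hfin _ (by simp)

/-- The graph of the intersecting Whitney cubes close to `x`. -/
def touchGraph (W : WhitneyCovering Ω) (x : Fin n → ℝ) : SimpleGraph (W.near x) :=
  SimpleGraph.fromRel fun Q Q' => (Q.1.1.toSet ∩ Q'.1.1.toSet).Nonempty

theorem nonempty_inter_of_adj {Q Q' : W.near x} (h : (W.touchGraph x).Adj Q Q') :
    (Q.1.1.toSet ∩ Q'.1.1.toSet).Nonempty := by
  rw [touchGraph, SimpleGraph.fromRel_adj] at h
  rcases h.2 with h | h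
  · exact h
  · rwa [inter_comm]

/-- Connectedness of the ball around `x`: the cubes reachable from `Q` and the remaining ones have
closed unions that both meet the ball and together cover it. They therefore share a point, which
supplies an edge between the two classes. -/
theorem reachable_touchGraph (hx : x ∈ Ω.carrier) (hfin : (W.near x).Finite) (Q Q' : W.near x) :
    (W.touchGraph x).Reachable Q Q' := by
  by_contra hn
  have := hfin.to_subtype
  have hD := W.bdryDist_pos hx
  set B := Metric.closedBall x (Ω.bdryDist x / 4)
  have hclosed : ∀ s : Set (W.near x), IsClosed (⋃ q ∈ s, q.1.1.toSet) := fun s =>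
    s.toFinite.isClosed_biUnion fun q _ => Metric.isClosed_closedBall
  set s : Set (W.near x) := {q | (W.touchGraph x).Reachable Q q}
  have hB : IsPreconnected B := (convex_closedBall _ _).isPreconnected
  have hcov : B ⊆ (⋃ q ∈ s, q.1.1.toSet) ∪ ⋃ q ∈ sᶜ, q.1.1.toSet := by
    intro y hy
    have hyΩ : y ∈ Ω.carrier := Domain.ball_bdryDist_subset hx
      (Metric.closedBall_subset_ball (by linarith) hy)
    obtain ⟨q, hq⟩ := W.exists_mem hyΩ
    by_cases hqs : (⟨q, y, hq, hy⟩ : W.near x) ∈ s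
    · exact Or.inl (mem_biUnion hqs hq)
    · exact Or.inr (mem_biUnion (s := sᶜ) hqs hq)
  have hmeet : ∀ (t : Set (W.near x)) (q : W.near x), q ∈ t →
      (B ∩ ⋃ q ∈ t, q.1.1.toSet).Nonempty := by
    intro t q hq
    obtain ⟨y, hy, hyB⟩ := q.2
    exact ⟨y, hyB, mem_biUnion hq hy⟩
  obtain ⟨y, -, hy1, hy2⟩ := isPreconnected_closed_iff.1 hB _ _ (hclosed s) (hclosed sᶜ) hcov
    (hmeet s Q (SimpleGraph.Reachable.refl _)) (hmeet sᶜ Q' hn)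
  obtain ⟨q, hq, hyq⟩ := mem_iUnion₂.1 hy1
  obtain ⟨q', hq', hyq'⟩ := mem_iUnion₂.1 hy2
  have hne : q ≠ q' := fun h => hq' (h ▸ hq)
  have hadj : (W.touchGraph x).Adj q q' := by
    rw [touchGraph, SimpleGraph.fromRel_adj]
    exact ⟨hne, Or.inl ⟨y, hyq, hyq'⟩⟩
  exact hq' (SimpleGraph.Reachable.trans hq hadj.reachable)

/-- A path repeats no vertex, so the overlap bound also bounds the length of chains. -/
theorem exists_walk_touchGraph (hx : x ∈ Ω.carrier) (hfin : (W.near x).Finite) (Q Q' : W.near x) :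
    ∃ w : (W.touchGraph x).Walk Q Q', w.length ≤ (W.near x).ncard := by
  classical
  have := hfin.fintype
  obtain ⟨p, hp⟩ := (reachable_touchGraph hx hfin Q Q').exists_isPath
  refine ⟨p, hp.length_lt.le.trans (le_of_eq ?_)⟩
  rw [← Nat.card_eq_fintype_card, Nat.card_coe_set_eq]

end WhitneyCovering

end WhitneyGeometry

end SplitTrace

namespace SplitTrace

/-! ### Partition of unity and estimates for the glued function -/

noncomputable section WhitneyExtension

variable {n : ℕ}

/-- The bump function adapted to a cube. -/
def Cube.bump (Q : Cube n) (x : Fin n → ℝ) : ℝ := unitBump n (Q.radius⁻¹ • (x - Q.center))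

theorem Cube.bump_nonneg (Q : Cube n) (x : Fin n → ℝ) : 0 ≤ Q.bump x := (unitBump n).nonneg

theorem Cube.bump_eq_one {Q : Cube n} {x : Fin n → ℝ} (hx : x ∈ Q.toSet) : Q.bump x = 1 := by
  have hr := Q.radius_pos
  apply (unitBump n).one_of_mem_closedBall
  rw [mem_closedBall_zero_iff, norm_smul, Real.norm_of_nonneg (by positivity), ← dist_eq_norm,
    inv_mul_le_iff₀ hr]
  simpa [unitBump] using Metric.mem_closedBall.1 hx

theorem Cube.dist_lt_of_bump_ne_zero {Q : Cube n} {x : Fin n → ℝ} (hx : Q.bump x ≠ 0) :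
    dist x Q.center < 5 / 4 * Q.radius := by
  have hr := Q.radius_pos
  have h : Q.radius⁻¹ • (x - Q.center) ∈ Function.support (unitBump n) := hx
  rw [ContDiffBump.support_eq, mem_ball_zero_iff, norm_smul, Real.norm_of_nonneg (by positivity),
    ← dist_eq_norm, inv_mul_lt_iff₀ hr] at h
  simp only [unitBump] at h
  linarith

namespace WhitneyCovering

variable {Ω : Domain n} {W : WhitneyCovering Ω} {x : Fin n → ℝ}

/-- One finite set of cubes serves all `y` close to `x`; hence the sums defining `glue` are locally
finite sums over a fixed index set and can be differentiated. -/
theorem mem_near_of_bump_ne_zero {y : Fin n → ℝ} {Q : W.cubes} (hQ : Q.1.bump y ≠ 0)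
    (hy : dist y x ≤ Ω.bdryDist x / 100) : Q ∈ W.near x := by
  have hr := Q.1.radius_pos
  have h1 := Cube.dist_lt_of_bump_ne_zero hQ
  -- Bumps are supported in the `5/4` dilation, so contracting `y` towards the center by `4/5` lands
  -- in `Q`, having moved less than a quarter of the radius.
  set z := AffineMap.lineMap Q.1.center y (4 / 5 : ℝ) with hz
  have hzc : dist z Q.1.center = 4 / 5 * dist Q.1.center y := by
    rw [hz, dist_lineMap_left]; norm_num
  have hzy : dist z y = 1 / 5 * dist Q.1.center y := by
    rw [hz, dist_lineMap_right]; norm_num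
  rw [dist_comm y] at h1
  have hzQ : z ∈ Q.1.toSet := by
    rw [Cube.toSet, Metric.mem_closedBall]
    linarith
  have h2 := W.two_radius_le hzQ
  have h3 := Ω.bdryDist_le_add z x
  have h4 := dist_triangle z y x
  refine ⟨z, hzQ, ?_⟩
  rw [Metric.mem_closedBall]
  linarith

theorem eventually_dist_le (hx : x ∈ Ω.carrier) (W : WhitneyCovering Ω) :
    ∀ᶠ y in 𝓝 x, dist y x ≤ Ω.bdryDist x / 100 :=
  Metric.closedBall_mem_nhds x (by linarith [W.bdryDist_pos hx])

theorem finsum_bump_mul_eventuallyEq (hx : x ∈ Ω.carrier) (hfin : (W.near x).Finite)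
    (P : W.cubes → (Fin n → ℝ) → ℝ) :
    (fun y => ∑ᶠ Q : W.cubes, Q.1.bump y * P Q y) =ᶠ[𝓝 x]
      ∑ Q ∈ hfin.toFinset, Q.1.bump * P Q := by
  filter_upwards [eventually_dist_le hx W] with y hy
  rw [finsum_eq_sum_of_support_subset (s := hfin.toFinset), Finset.sum_apply]
  · rfl
  · intro Q hQ
    simp only [Finite.coe_toFinset]
    exact mem_near_of_bump_ne_zero (left_ne_zero_of_mul hQ) hy

/-- The weighted average of the functions `P Q` with respect to the partition of unity subordinate
to a Whitney covering. -/
def glue (W : WhitneyCovering Ω) (P : W.cubes → (Fin n → ℝ) → ℝ) (x : Fin n → ℝ) : ℝ :=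
  (∑ᶠ Q : W.cubes, Q.1.bump x * P Q x) * (∑ᶠ Q : W.cubes, Q.1.bump x)⁻¹

theorem one_le_sum_bump (hx : x ∈ Ω.carrier) (hfin : (W.near x).Finite) :
    1 ≤ (∑ Q ∈ hfin.toFinset, Q.1.bump) x := by
  obtain ⟨Q, hQ⟩ := W.exists_mem hx
  rw [Finset.sum_apply, ← Cube.bump_eq_one hQ]
  refine Finset.single_le_sum (f := fun Q : W.cubes => Q.1.bump x)
    (fun Q _ => Cube.bump_nonneg _ _) ?_
  simpa using mem_near_of_mem hx hQ

/-- The normalized weights sum to one, so `R` can be subtracted inside the average. -/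
theorem glue_sub_eventuallyEq (hx : x ∈ Ω.carrier) (hfin : (W.near x).Finite)
    {P : W.cubes → (Fin n → ℝ) → ℝ} (hP : ∀ Q : W.cubes, ContinuousAt Q.1.bump x)
    (R : (Fin n → ℝ) → ℝ) :
    W.glue P - R =ᶠ[𝓝 x] (∑ Q ∈ hfin.toFinset, Q.1.bump * (P Q - R)) *
      (∑ Q ∈ hfin.toFinset, Q.1.bump)⁻¹ := by
  have hcont : ContinuousAt (∑ Q ∈ hfin.toFinset, Q.1.bump) x := by
    refine ContinuousAt.congr (f := fun y => ∑ Q ∈ hfin.toFinset, Q.1.bump y)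
      (tendsto_finsetSum hfin.toFinset fun Q _ => hP Q) (Eventually.of_forall fun y => ?_)
    exact (Finset.sum_apply y _ _).symm
  have hne := hcont.eventually_ne (zero_lt_one.trans_le (one_le_sum_bump hx hfin)).ne'
  filter_upwards [finsum_bump_mul_eventuallyEq hx hfin P,
    finsum_bump_mul_eventuallyEq hx hfin (fun _ _ => 1), hne] with y h1 h2 h3
  rw [Finset.sum_apply] at h3
  simp only [mul_one, Finset.sum_apply, Pi.mul_apply] at h2
  simp only [Pi.sub_apply, glue, h1, h2, Pi.mul_apply, Pi.inv_apply, Finset.sum_apply, mul_sub,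
    Finset.sum_sub_distrib, ← Finset.sum_mul, sub_mul]
  rw [mul_right_comm, mul_inv_cancel₀ h3, one_mul]

variable {a : W.cubes → Fin n → ℝ} {b : W.cubes → ℝ} {g : W.cubes → Fin n → ℝ} {η : ℝ}

/-- The hypotheses of the extension theorem: a Whitney field of order one whose values at the points
`a Q` are `b Q` and whose gradients are `g Q`. -/
def IsWhitneyField (W : WhitneyCovering Ω) (a : W.cubes → Fin n → ℝ) (b : W.cubes → ℝ)
    (g : W.cubes → Fin n → ℝ) (η : ℝ) : Prop :=
  ∀ Q Q' : W.cubes, (Q.1.toSet ∩ Q'.1.toSet).Nonempty →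
    |b Q - b Q' - g Q' ⬝ᵥ (a Q - a Q')| ≤ η * (Q.1.diam + Q'.1.diam) ^ 2 ∧
      ‖g Q - g Q'‖ ≤ η * (Q.1.diam + Q'.1.diam)

/-- In units of `Ω.bdryDist x`, the center is within `7/8` of `x` and its own boundary distance is
at most `1 + 7/8`; the total is `11/4`. -/
theorem dist_nearest_le (ha : ∀ Q : W.cubes, Ω.IsNearest Q.1.center (a Q)) {Q : W.cubes}
    (hQ : Q ∈ W.near x) : dist x (a Q) ≤ 11 / 4 * Ω.bdryDist x := by
  have h1 := dist_center_le_of_mem_near hQ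
  have h2 : dist (a Q) Q.1.center = Ω.bdryDist Q.1.center := (ha Q).2
  have h3 := Ω.bdryDist_le_add Q.1.center x
  have h4 := dist_triangle x Q.1.center (a Q)
  rw [dist_comm x Q.1.center, dist_comm Q.1.center (a Q)] at h4
  linarith

theorem jetBound_sub_of_touch (ha : ∀ Q : W.cubes, Ω.IsNearest Q.1.center (a Q)) (hη : 0 < η)
    (hg : W.IsWhitneyField a b g η) (hx : x ∈ Ω.carrier) {Q Q' : W.cubes} (hQ : Q ∈ W.near x)
    (hQ' : Q' ∈ W.near x) (h : (Q.1.toSet ∩ Q'.1.toSet).Nonempty) :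
    JetBound x (Ω.bdryDist x) (affineJet (b Q) (g Q) (a Q) - affineJet (b Q') (g Q') (a Q'))
      ((7 + 7 * n) * η * Ω.bdryDist x ^ 2) := by
  have := W.dimension_ne_zero
  have hD := W.bdryDist_pos hx
  obtain ⟨h1, h2⟩ := hg Q Q' h
  rw [Cube.diam_eq, Cube.diam_eq] at h1 h2
  have hsum : 2 * Q.1.radius + 2 * Q'.1.radius ≤ 5 / 2 * Ω.bdryDist x := by
    linarith [radius_le_of_mem_near hQ, radius_le_of_mem_near hQ']
  have hpos : 0 ≤ 2 * Q.1.radius + 2 * Q'.1.radius := by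
    linarith [Q.1.radius_pos, Q'.1.radius_pos]
  rw [affineJet_sub]
  refine JetBound.affineJet hD (M₀ := η * (5 / 2 * Ω.bdryDist x) ^ 2)
    (M₁ := η * (5 / 2 * Ω.bdryDist x)) (h1.trans (by gcongr)) (h2.trans (by gcongr)) ?_ ?_
  · have h3 := dist_nearest_le ha hQ
    rw [dist_eq_norm] at h3
    have hn : (0 : ℝ) ≤ n := Nat.cast_nonneg n
    calc η * (5 / 2 * Ω.bdryDist x) ^ 2 + n * (η * (5 / 2 * Ω.bdryDist x) * ‖x - a Q‖)
        ≤ η * (5 / 2 * Ω.bdryDist x) ^ 2 +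
          n * (η * (5 / 2 * Ω.bdryDist x) * (11 / 4 * Ω.bdryDist x)) := by gcongr
      _ = (25 / 4 + 55 / 8 * n) * (η * Ω.bdryDist x ^ 2) := by ring
      _ ≤ (7 + 7 * n) * (η * Ω.bdryDist x ^ 2) := by gcongr <;> norm_num
      _ = _ := by ring
  · calc Ω.bdryDist x * (η * (5 / 2 * Ω.bdryDist x)) = 5 / 2 * (η * Ω.bdryDist x ^ 2) := by ring
      _ ≤ (7 + 7 * n) * (η * Ω.bdryDist x ^ 2) := by
          gcongr
          linarith [(Nat.cast_nonneg n : (0 : ℝ) ≤ n)]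
      _ = _ := by ring

/-- Telescoping along the chain of touching cubes. -/
theorem jetBound_sub_of_walk (ha : ∀ Q : W.cubes, Ω.IsNearest Q.1.center (a Q)) (hη : 0 < η)
    (hg : W.IsWhitneyField a b g η) (hx : x ∈ Ω.carrier) {Q Q' : W.near x}
    (w : (W.touchGraph x).Walk Q Q') :
    JetBound x (Ω.bdryDist x)
      (affineJet (b Q) (g Q) (a Q) - affineJet (b Q') (g Q') (a Q'))
      (w.length * ((7 + 7 * n) * η * Ω.bdryDist x ^ 2)) := by
  induction w with
  | nil => simpa using JetBound.zero x _
  | cons hadj w ih =>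
    have h1 := jetBound_sub_of_touch ha hη hg hx (Subtype.prop _) (Subtype.prop _)
      (nonempty_inter_of_adj hadj)
    have h2 := h1.add ih (W.bdryDist_pos hx)
    rw [sub_add_sub_cancel] at h2
    refine h2.mono (le_of_eq ?_)
    rw [SimpleGraph.Walk.length_cons]
    push_cast
    ring

theorem jetBound_bump {K : ℝ} (hK : ∀ x, JetBound x 1 (unitBump n) K) (hx : x ∈ Ω.carrier)
    {Q : W.cubes} (hQ : Q ∈ W.near x) :
    JetBound x (Ω.bdryDist x) Q.1.bump (14 ^ 2 * K) := by
  have hr := Q.1.radius_pos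
  refine JetBound.comp_smul_sub hK Q.1.center (s := Q.1.radius⁻¹) (by positivity)
    (W.bdryDist_pos hx) (by norm_num) ?_ x
  -- Near cubes have radius at least `3/40` of the boundary distance, and `40/3 ≤ 14`.
  rw [← div_eq_mul_inv, div_le_iff₀ hr]
  linarith [le_radius_of_mem_near hQ]

theorem exists_jetBound_glue_sub (n : ℕ) : ∃ C : ℝ, 0 < C ∧
    ∀ (Ω : Domain n) (W : WhitneyCovering Ω) (a : W.cubes → Fin n → ℝ),
      (∀ Q : W.cubes, Ω.IsNearest Q.1.center (a Q)) →
      ∀ (b : W.cubes → ℝ) (g : W.cubes → Fin n → ℝ) (η : ℝ), 0 < η → W.IsWhitneyField a b g η →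
      ∀ (Q₀ : W.cubes) (x : Fin n → ℝ), x ∈ Q₀.1.toSet →
        JetBound x (Ω.bdryDist x)
          (W.glue (fun Q => affineJet (b Q) (g Q) (a Q)) - affineJet (b Q₀) (g Q₀) (a Q₀))
          (C * η * Ω.bdryDist x ^ 2) := by
  obtain ⟨K, hK1, hK⟩ := exists_bound_partialDeriv (unitBump n).contDiff (unitBump n).hasCompactSupport
  obtain ⟨N, hN⟩ := exists_card_near_le n
  -- Outer 4: product of numerator and inverse of the sum of bumps. Numerator: at most `N` products
  -- of a bump with a difference along a chain of at most `N` links. The final `+ 1` only ensures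
  -- positivity.
  refine ⟨4 * ((N * (4 * (14 ^ 2 * K * (N * (7 + 7 * n))))) * (3 * (N * (14 ^ 2 * K)) ^ 2)) + 1,
    by positivity, fun Ω W a ha b g η hη hg Q₀ x hxQ => ?_⟩
  have hx := W.toSet_subset Q₀ hxQ
  have hD := W.bdryDist_pos hx
  obtain ⟨hfin, hcard⟩ := hN Ω W x hx
  have hcard' : (hfin.toFinset.card : ℝ) ≤ N := by
    rw [← Set.ncard_eq_toFinset_card _ hfin]
    exact_mod_cast hcard
  have hbump : ∀ Q ∈ hfin.toFinset, JetBound x (Ω.bdryDist x) Q.1.bump (14 ^ 2 * K) :=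
    fun Q hQ => jetBound_bump hK hx (by simpa using hQ)
  have hB := (JetBound.sum hfin.toFinset hD hbump).mono
    (M' := N * (14 ^ 2 * K)) (by gcongr)
  have hA : JetBound x (Ω.bdryDist x) (∑ Q ∈ hfin.toFinset, Q.1.bump *
      (affineJet (b Q) (g Q) (a Q) - affineJet (b Q₀) (g Q₀) (a Q₀)))
      (N * (4 * (14 ^ 2 * K * (N * ((7 + 7 * n) * η * Ω.bdryDist x ^ 2))))) := by
    refine (JetBound.sum (M := 4 * (14 ^ 2 * K * (N * ((7 + 7 * n) * η * Ω.bdryDist x ^ 2))))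
      hfin.toFinset hD fun Q hQ => ?_).mono (by gcongr)
    refine (hbump Q hQ).mul ?_ hD
    obtain ⟨w, hw⟩ := exists_walk_touchGraph hx hfin ⟨Q, by simpa using hQ⟩
      ⟨Q₀, mem_near_of_mem hx hxQ⟩
    refine (jetBound_sub_of_walk ha hη hg hx w).mono ?_
    gcongr
    exact_mod_cast hw.trans hcard
  have hcont : ∀ Q : W.cubes, ContinuousAt Q.1.bump x := fun Q => by
    have h1 : Continuous (unitBump n) := (unitBump n).continuous
    have h2 : Continuous fun x : Fin n → ℝ => Q.1.radius⁻¹ • (x - Q.1.center) := by fun_prop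
    exact (h1.comp h2).continuousAt
  refine ((hA.mul (hB.inv hD (one_le_sum_bump hx hfin)) hD).congr
    (glue_sub_eventuallyEq hx hfin hcont _)).mono ?_
  have : 0 ≤ η * Ω.bdryDist x ^ 2 := by positivity
  linarith

/-- The glued function is `C²`, with bounded second derivatives, and is close to first order
to the Whitney field. -/
theorem exists_glue_bounds (n : ℕ) : ∃ C : ℝ, 0 < C ∧
    ∀ (Ω : Domain n) (W : WhitneyCovering Ω) (a : W.cubes → Fin n → ℝ),
      (∀ Q : W.cubes, Ω.IsNearest Q.1.center (a Q)) →
      ∀ (b : W.cubes → ℝ) (g : W.cubes → Fin n → ℝ) (η : ℝ), 0 < η → W.IsWhitneyField a b g η →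
      ∃ F : (Fin n → ℝ) → ℝ, ∀ (Q : W.cubes) (x : Fin n → ℝ), x ∈ Q.1.toSet →
        ContDiffAt ℝ 2 F x ∧
        |F x - affineJet (b Q) (g Q) (a Q) x| ≤ C * η * Ω.bdryDist x ^ 2 ∧
        (∀ i, |partialDeriv i F x - g Q i| ≤ C * η * Ω.bdryDist x) ∧
        ∀ i j, |partialDeriv i (partialDeriv j F) x| ≤ C * η := by
  obtain ⟨C, hC, H⟩ := exists_jetBound_glue_sub n
  refine ⟨C, hC, fun Ω W a ha b g η hη hg =>
    ⟨W.glue (fun Q => affineJet (b Q) (g Q) (a Q)), fun Q x hx => ?_⟩⟩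
  have hD := W.bdryDist_pos (W.toSet_subset Q hx)
  have J := H Ω W a ha b g η hη hg Q x hx
  set F := W.glue (fun Q => affineJet (b Q) (g Q) (a Q))
  set P := affineJet (b Q) (g Q) (a Q) with hPdef
  have hP : ContDiffAt ℝ 2 P x := (contDiff_affineJet _ _ _).contDiffAt
  have hF : ContDiffAt ℝ 2 F x := by
    refine (J.1.add hP).congr_of_eventuallyEq (Eventually.of_forall fun y => ?_)
    simp
  refine ⟨hF, J.2, fun i => ?_, fun i j => ?_⟩
  · have h1 := J.3 i
    have h2 := partialDeriv_add i (J.1.differentiableAt (by norm_num))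
      (hP.differentiableAt (by norm_num))
    rw [sub_add_cancel, hPdef, partialDeriv_affineJet] at h2
    rw [h2, add_sub_cancel_right]
    have h3 : Ω.bdryDist x * |partialDeriv i (F - P) x| ≤ Ω.bdryDist x * (C * η * Ω.bdryDist x) :=
      h1.trans (le_of_eq (by ring))
    exact le_of_mul_le_mul_left h3 hD
  · have h1 := J.4 i j
    have h2 := partialDeriv_partialDeriv_add i j J.1 hP
    rw [sub_add_cancel, hPdef, partialDeriv_affineJet] at h2
    have h0 : partialDeriv i (fun _ => g Q j) x = 0 := by simp [partialDeriv]
    rw [h2, h0, add_zero]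
    refine le_of_mul_le_mul_left (h1.trans (le_of_eq (mul_comm _ _))) (by positivity)

end WhitneyCovering

end WhitneyExtension

end SplitTrace

namespace SplitTrace

/-! ### Convergence to the split boundary and the trace -/

section Trace

variable {n : ℕ} {Ω : Domain n}

theorem opNorm_le_of_apply_single (L : (Fin n → ℝ) →L[ℝ] ℝ) {K : ℝ}
    (hK : ∀ i, |L (Pi.single i 1)| ≤ K) (hK0 : 0 ≤ K) : ‖L‖ ≤ n * K := by
  refine L.opNorm_le_bound (by positivity) fun v => ?_
  have hv : L v = (fun i => L (Pi.single i 1)) ⬝ᵥ v := by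
    conv_lhs => rw [pi_eq_sum_univ' v]
    simp only [map_sum, map_smul, dotProduct, smul_eq_mul]
    refine Finset.sum_congr rfl fun i _ => ?_
    rw [mul_comm]
  rw [hv, Real.norm_eq_abs, mul_assoc]
  refine (abs_dotProduct_le _ _).trans ?_
  gcongr
  exact (pi_norm_le_iff_of_nonneg hK0).2 hK

/-- A function whose derivative is bounded on `Ω` is Lipschitz along the curves in `Ω`. -/
theorem edist_le_mul_eVariationOn {G : (Fin n → ℝ) → ℝ} {K : NNReal}
    (hG : ∀ x ∈ Ω.carrier, DifferentiableAt ℝ G x) (hK : ∀ x ∈ Ω.carrier, ‖fderiv ℝ G x‖ ≤ K)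
    {x y : Fin n → ℝ} {c : ℝ → Fin n → ℝ} (hc : IsCurveIn Ω.carrier x y c) :
    edist (G x) (G y) ≤ K * eVariationOn c (Icc 0 1) := by
  obtain ⟨hcont, hmaps, h0, h1⟩ := hc
  have hball : ∀ p : Ω.carrier, ∃ r > 0, Metric.ball p.1 r ⊆ Ω.carrier := fun p =>
    Metric.isOpen_iff.1 Ω.isOpen p.1 p.2
  choose r hr hsub using hball
  have hopen : ∀ p : Ω.carrier,
      IsOpen ((fun t : Icc (0 : ℝ) 1 => c t) ⁻¹' Metric.ball p.1 (r p)) := fun p =>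
    Metric.isOpen_ball.preimage (continuousOn_iff_continuous_domRestrict.1 hcont)
  -- `Ω` is not convex, so the curve is cut into finitely many pieces, each inside a ball contained
  -- in `Ω`, where the mean value inequality applies.
  obtain ⟨t, ht0, hmono, ⟨m, hm⟩, ht⟩ := exists_monotone_Icc_subset_open_cover_Icc zero_le_one hopen
    (fun s _ => mem_iUnion.2 ⟨⟨c s, hmaps s.2⟩, Metric.mem_ball_self (hr _)⟩)
  have hstep : ∀ i, edist (G (c (t i))) (G (c (t (i + 1)))) ≤
      K * edist (c (t (i + 1))) (c (t i)) := by
    intro i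
    obtain ⟨p, hp⟩ := ht i
    have hl : LipschitzOnWith K G (Metric.ball p.1 (r p)) :=
      (convex_ball _ _).lipschitzOnWith_of_nnnorm_fderiv_le
        (fun z hz => hG z (hsub p hz)) (fun z hz => hK z (hsub p hz))
    have hle := hmono (Nat.le_succ i)
    rw [edist_comm (c _)]
    exact hl (hp (left_mem_Icc.2 hle)) (hp (right_mem_Icc.2 hle))
  have hsum := edist_le_range_sum_edist (fun i => G (c (t i))) m
  simp only [ht0, hm m le_rfl, h0, h1] at hsum
  refine hsum.trans ((Finset.sum_le_sum fun i _ => hstep i).trans ?_)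
  rw [← Finset.mul_sum]
  gcongr
  exact eVariationOn.sum_le (u := fun i => (t i : ℝ)) (fun i j hij => hmono hij) fun i => (t i).2

theorem abs_sub_le_mul_dist {G : (Fin n → ℝ) → ℝ} {K : ℝ} (hK0 : 0 < K)
    (hG : ∀ x ∈ Ω.carrier, DifferentiableAt ℝ G x) (hK : ∀ x ∈ Ω.carrier, ‖fderiv ℝ G x‖ ≤ K)
    (x y : Ω.Pt) : |G x.val - G y.val| ≤ K * dist x y := by
  lift K to NNReal using hK0.le
  have hK1 : (K : ENNReal) ≠ 0 := by exact_mod_cast hK0.ne'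
  have h1 : edist (G x.val) (G y.val) ≤ K * curveDist Ω.carrier x.val y.val := by
    rw [← ENNReal.div_le_iff' hK1 ENNReal.coe_ne_top]
    refine le_iInf₂ fun c hc => ?_
    rw [ENNReal.div_le_iff' hK1 ENNReal.coe_ne_top]
    exact edist_le_mul_eVariationOn hG hK hc
  have h2 := curveDist_lt_top Ω.isOpen Ω.isPathConnected.isConnected.isPreconnected x.mem y.mem
  have h3 := ENNReal.toReal_mono (ENNReal.mul_ne_top ENNReal.coe_ne_top h2.ne) h1
  rw [← dist_edist, Real.dist_eq, ENNReal.toReal_mul, ENNReal.coe_toReal] at h3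
  exact h3

namespace Domain

theorem dist_le_of_mem_ball {c : Ω.Pt} {r : ℝ} (hr : Metric.ball c.val r ⊆ Ω.carrier) {x y : Ω.Pt}
    (hx : x.val ∈ Metric.ball c.val r) (hy : y.val ∈ Metric.ball c.val r) :
    dist x y ≤ dist x.val y.val :=
  dist_le_of_segment _ _ (((convex_ball _ _).segment_subset hx hy).trans hr)

/-- A ball of `ℝⁿ` inside `Ω` contains every element of the completion close to its center. -/
theorem ball_subset_range_coe {c : Ω.Pt} {r : ℝ} (hr : Metric.ball c.val r ⊆ Ω.carrier) :
    Metric.ball (c : Ω.Completion) (r / 2) ⊆ range fun x : Ω.Pt => (x : Ω.Completion) := by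
  intro p hp
  have hr0 : 0 < r := by
    have := dist_nonneg.trans_lt (Metric.mem_ball.1 hp)
    linarith
  have hdense : p ∈ closure (range fun x : Ω.Pt => (x : Ω.Completion)) :=
    UniformSpace.Completion.denseRange_coe p
  obtain ⟨u, hu, hlim⟩ := mem_closure_iff_seq_limit.1 hdense
  choose z hz using hu
  obtain rfl : (fun k => ((z k : Ω.Pt) : Ω.Completion)) = u := funext hz
  have hcau := hlim.cauchySeq
  -- The intrinsic metric dominates the norm, so the sequence also converges in `ℝⁿ`. Its limit
  -- stays in the ball, where segments make the norm dominate the intrinsic metric, so the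
  -- convergence is intrinsic too.
  have hcauv : CauchySeq fun k => (z k).val := by
    rw [Metric.cauchySeq_iff] at hcau ⊢
    intro ε hε
    obtain ⟨N, hN⟩ := hcau ε hε
    exact ⟨N, fun i hi j hj => (dist_val_le _ _).trans_lt (by
      rw [← UniformSpace.Completion.dist_eq]
      exact hN i hi j hj)⟩
  obtain ⟨w, hw⟩ := cauchySeq_tendsto_of_complete hcauv
  have hev : ∀ᶠ k in atTop, dist (z k).val c.val ≤ r / 2 := by
    filter_upwards [hlim (Metric.isOpen_ball.mem_nhds hp)] with k hk
    have : dist (z k : Ω.Completion) (c : Ω.Completion) < r / 2 := hk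
    rw [UniformSpace.Completion.dist_eq] at this
    exact (dist_val_le _ _).trans this.le
  have hwc : dist w c.val ≤ r / 2 := le_of_tendsto (hw.dist tendsto_const_nhds) hev
  have hwb : w ∈ Metric.ball c.val r := by rw [Metric.mem_ball]; linarith
  let w' : Ω.Pt := ⟨w, hr hwb⟩
  have hzw : Tendsto z atTop (𝓝 w') := by
    rw [tendsto_iff_dist_tendsto_zero] at hw ⊢
    refine squeeze_zero' (Eventually.of_forall fun _ => dist_nonneg) ?_ hw
    filter_upwards [hev] with k hk
    exact dist_le_of_mem_ball hr (by rw [Metric.mem_ball]; linarith) hwb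
  exact ⟨w', tendsto_nhds_unique
    (((UniformSpace.Completion.continuous_coe Ω.Pt).tendsto w').comp hzw) hlim⟩

/-- If some late `y k` had boundary distance at least `ε`, a ball around it in the completion would
consist of points of `Ω` and contain `ω`, contradicting that `ω` is not interior. -/
theorem tendsto_bdryDist {ω : Ω.SplitBoundary} {y : ℕ → Ω.Pt}
    (hy : Tendsto (fun k => (y k : Ω.Completion)) atTop (𝓝 (ω : Ω.Completion))) :
    Tendsto (fun k => Ω.bdryDist (y k).val) atTop (𝓝 0) := by
  rw [Metric.tendsto_atTop] at hy ⊢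
  intro ε hε
  obtain ⟨N, hN⟩ := hy (ε / 2) (by positivity)
  refine ⟨N, fun k hk => ?_⟩
  rw [Real.dist_0_eq_abs, abs_of_nonneg (show 0 ≤ Ω.bdryDist (y k).val from Metric.infDist_nonneg)]
  by_contra! hle
  have hball : Metric.ball (y k).val ε ⊆ Ω.carrier :=
    (Metric.ball_subset_ball hle).trans (ball_bdryDist_subset (y k).mem)
  refine ω.2.2 (mem_interior.2 ⟨_, ball_subset_range_coe hball, Metric.isOpen_ball, ?_⟩)
  rw [Metric.mem_ball, dist_comm]
  exact hN k hk

end Domain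

namespace WhitneyCovering

variable {W : WhitneyCovering Ω}

/-- The ray stays within `Ω.bdryDist Q.1.center ≤ 10 * Q.1.radius` of the center and `x` within one
radius; `11` radii are at most `11/2` of the boundary distance of `x`. -/
theorem dist_omega_le {Q : W.cubes} {a : Fin n → ℝ} (ha : Ω.IsNearest Q.1.center a) {x : Ω.Pt}
    (hx : x.val ∈ Q.1.toSet) :
    dist (W.omega Q ha : Ω.Completion) (x : Ω.Completion) ≤ 6 * Ω.bdryDist x.val := by
  let c : Ω.Pt := ⟨Q.1.center, W.center_mem Q⟩
  have hd : dist a Q.1.center = Ω.bdryDist Q.1.center := ha.2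
  have hball := Domain.ball_bdryDist_subset c.mem
  have hcx : dist c x ≤ Q.1.radius := by
    have h1 : dist x.val c.val ≤ Q.1.radius := hx
    have h2 := W.two_radius_le Q.1.center_mem_toSet
    have h3 := Q.1.radius_pos
    rw [dist_comm]
    refine (Domain.dist_le_of_mem_ball hball ?_ ?_).trans h1
    · rw [Metric.mem_ball]
      exact h1.trans_lt (by simp only [c]; linarith)
    · exact Metric.mem_ball_self (W.bdryDist_pos c.mem)
  have hray : ∀ i, dist (Domain.ray (W.center_mem Q) ha i) c ≤ Ω.bdryDist Q.1.center := by
    intro i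
    have hpos := W.bdryDist_pos (W.center_mem Q)
    have ht0 : (0 : ℝ) < 1 / ((i : ℝ) + 1) := by positivity
    have ht1 : 1 / ((i : ℝ) + 1) ≤ 1 := by
      rw [div_le_one (by positivity)]
      linarith [(Nat.cast_nonneg i : (0 : ℝ) ≤ i)]
    have hval : (Domain.ray (W.center_mem Q) ha i).val =
        AffineMap.lineMap a Q.1.center (1 / ((i : ℝ) + 1)) := by
      simp only [Domain.ray, AffineMap.lineMap_apply, vsub_eq_sub, vadd_eq_add]
      rw [add_comm]
    have h1 : dist (Domain.ray (W.center_mem Q) ha i).val c.val < Ω.bdryDist Q.1.center := by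
      rw [hval, dist_lineMap_right, hd, Real.norm_of_nonneg (by linarith)]
      nlinarith
    exact (Domain.dist_le_of_mem_ball hball h1 (Metric.mem_ball_self hpos)).trans h1.le
  have hlim := (Domain.tendsto_ray (W.center_mem Q) ha).dist
    (tendsto_const_nhds (x := (x : Ω.Completion)))
  refine le_of_tendsto hlim (Eventually.of_forall fun i => ?_)
  rw [UniformSpace.Completion.dist_eq]
  linarith [dist_triangle (Domain.ray (W.center_mem Q) ha i) c x, hray i,
    W.bdryDist_le Q.1.center_mem_toSet, W.two_radius_le hx,
    Q.1.radius_pos]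

theorem tendsto_omega {ω : Ω.SplitBoundary} {y : ℕ → Ω.Pt}
    (hy : Tendsto (fun k => (y k : Ω.Completion)) atTop (𝓝 (ω : Ω.Completion)))
    {a : W.cubes → Fin n → ℝ} (ha : ∀ Q : W.cubes, Ω.IsNearest Q.1.center (a Q))
    {Q : ℕ → W.cubes} (hQ : ∀ k, (y k).val ∈ (Q k).1.toSet) :
    Tendsto (fun k => W.omega (Q k) (ha (Q k))) atTop (𝓝 ω) := by
  rw [tendsto_subtype_rng]
  have hd := (Domain.tendsto_bdryDist hy).const_mul 6
  rw [tendsto_iff_dist_tendsto_zero] at hy ⊢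
  have hs := hd.add hy
  rw [mul_zero, add_zero] at hs
  refine squeeze_zero (fun _ => dist_nonneg) (fun k => ?_) hs
  exact (dist_triangle _ (y k : Ω.Completion) _).trans
    (add_le_add_left (dist_omega_le (ha (Q k)) (hQ k)) _)

/-- A function with bounded second derivatives that is close to first order to a Whitney field has
the trace from which the field is built. -/
theorem isTrace_of_bounds {a : W.cubes → Fin n → ℝ}
    (ha : ∀ Q : W.cubes, Ω.IsNearest Q.1.center (a Q)) {f : Ω.SplitBoundary → ℝ}
    (hf : Continuous f) {g : W.cubes → Fin n → ℝ} {F : (Fin n → ℝ) → ℝ} {K : ℝ} (hK : 0 < K)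
    (hF : ∀ (Q : W.cubes) (x : Fin n → ℝ), x ∈ Q.1.toSet →
      ContDiffAt ℝ 2 F x ∧
      |F x - affineJet (f (W.omega Q (ha Q))) (g Q) (a Q) x| ≤ K * Ω.bdryDist x ^ 2 ∧
      (∀ i, |partialDeriv i F x - g Q i| ≤ K * Ω.bdryDist x) ∧
      ∀ i j, |partialDeriv i (partialDeriv j F) x| ≤ K) :
    IsTrace Ω F f := by
  intro ω y hy
  choose Q hQ using fun k => W.exists_mem (y k).mem
  have hd := Domain.tendsto_bdryDist hy
  have hfω := (hf.tendsto ω).comp (tendsto_omega hy ha hQ)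
  have : NeZero n := W.dimension_ne_zero
  have hn : (0 : ℝ) < n := by exact_mod_cast Nat.pos_of_ne_zero (NeZero.ne n)
  -- A convergent sequence is bounded in the intrinsic metric, the metric in which the gradient of
  -- `F` is Lipschitz; this bounds the gradient along the sequence.
  obtain ⟨R, hR⟩ : ∃ R, ∀ k, dist (y k) (y 0) ≤ R := by
    obtain ⟨R, hR⟩ := (Metric.isBounded_iff.1 (Metric.isBounded_range_of_tendsto _ hy))
    refine ⟨R, fun k => ?_⟩
    rw [← UniformSpace.Completion.dist_eq]
    exact hR ⟨k, rfl⟩ ⟨0, rfl⟩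
  have hgrad : ∀ i k, |partialDeriv i F (y k).val| ≤
      |partialDeriv i F (y 0).val| + n * K * R := by
    intro i k
    have h1 := abs_sub_le_mul_dist (Ω := Ω) (G := partialDeriv i F) (K := n * K) (by positivity)
      (fun x hx => by
        obtain ⟨q, hq⟩ := W.exists_mem hx
        exact differentiableAt_partialDeriv i (hF q x hq).1)
      (fun x hx => by
        obtain ⟨q, hq⟩ := W.exists_mem hx
        exact opNorm_le_of_apply_single _ (fun j => (hF q x hq).2.2.2 j i) hK.le) (y k) (y 0)
    have h2 : n * K * dist (y k) (y 0) ≤ n * K * R := by gcongr; exact hR k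
    have h3 := abs_add_le (partialDeriv i F (y k).val - partialDeriv i F (y 0).val)
      (partialDeriv i F (y 0).val)
    rw [sub_add_cancel] at h3
    linarith
  set M := ∑ i, |partialDeriv i F (y 0).val| + n * K * R
  have hR0 : 0 ≤ R := dist_nonneg.trans (hR 0)
  have hM0 : 0 ≤ M := add_nonneg (Finset.sum_nonneg fun i _ => abs_nonneg _) (by positivity)
  have hg : ∀ k, ‖g (Q k)‖ ≤ M + K * Ω.bdryDist (y k).val := by
    intro k
    have hpos := W.bdryDist_pos (y k).mem
    refine (pi_norm_le_iff_of_nonneg (by positivity)).2 fun i => ?_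
    have h1 := (hF (Q k) _ (hQ k)).2.2.1 i
    have h2 := hgrad i k
    have h3 := Finset.single_le_sum (f := fun i => |partialDeriv i F (y 0).val|)
      (fun i _ => abs_nonneg _) (Finset.mem_univ i)
    have h4 := abs_sub_le (g (Q k) i) (partialDeriv i F (y k).val) 0
    rw [sub_zero, sub_zero, abs_sub_comm] at h4
    rw [Real.norm_eq_abs]
    simp only [M]
    linarith
  -- The affine function is compared with its value at `a (Q k)`; that point is at distance
  -- `O(Ω.bdryDist (y k).val)`, and the gradient `g (Q k)` is bounded by `hg`.
  have hbound : ∀ k, |F (y k).val - f (W.omega (Q k) (ha (Q k)))| ≤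
      K * Ω.bdryDist (y k).val ^ 2 +
        n * ((M + K * Ω.bdryDist (y k).val) * (11 / 4 * Ω.bdryDist (y k).val)) := by
    intro k
    have h1 := (hF (Q k) _ (hQ k)).2.1
    have h2 := dist_nearest_le ha (mem_near_of_mem (y k).mem (hQ k))
    rw [dist_eq_norm] at h2
    have h3 := (hg k)
    have h4 : |g (Q k) ⬝ᵥ ((y k).val - a (Q k))| ≤
        n * ((M + K * Ω.bdryDist (y k).val) * (11 / 4 * Ω.bdryDist (y k).val)) := by
      refine (abs_dotProduct_le _ _).trans ?_
      have := (norm_nonneg _).trans h3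
      gcongr
    rw [affineJet, ← sub_sub] at h1
    have h5 := abs_add_le (F (y k).val - f (W.omega (Q k) (ha (Q k))) -
      g (Q k) ⬝ᵥ ((y k).val - a (Q k))) (g (Q k) ⬝ᵥ ((y k).val - a (Q k)))
    rw [sub_add_cancel] at h5
    linarith
  have hlim : Tendsto (fun k => K * Ω.bdryDist (y k).val ^ 2 +
      n * ((M + K * Ω.bdryDist (y k).val) * (11 / 4 * Ω.bdryDist (y k).val))) atTop (𝓝 0) := by
    have := ((hd.pow 2).const_mul K).add
      ((((hd.const_mul K).const_add M).mul (hd.const_mul (11 / 4))).const_mul (n : ℝ))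
    simpa using this
  have hdiff : Tendsto (fun k => F (y k).val - f (W.omega (Q k) (ha (Q k)))) atTop (𝓝 0) :=
    squeeze_zero_norm hbound hlim
  have := hdiff.add hfω
  simpa using this

end WhitneyCovering

theorem c2Seminorm_le {F : (Fin n → ℝ) → ℝ} {K : ℝ}
    (hF : ∀ x ∈ Ω.carrier, ∀ i j, |partialDeriv i (partialDeriv j F) x| ≤ K) :
    c2Seminorm Ω F ≤ ENNReal.ofReal (n * n * K) := by
  calc c2Seminorm Ω F
      ≤ ∑ p : Fin n × Fin n, ⨆ x ∈ Ω.carrier,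
          ENNReal.ofReal |partialDeriv p.1 (partialDeriv p.2 F) x| :=
        Finset.sum_le_sum_of_subset (Finset.filter_subset _ _)
    _ ≤ ∑ _p : Fin n × Fin n, ENNReal.ofReal K := Finset.sum_le_sum fun p _ =>
        iSup₂_le fun x hx => ENNReal.ofReal_le_ofReal (hF x hx p.1 p.2)
    _ = ENNReal.ofReal (n * n * K) := by
        rw [ENNReal.ofReal_mul (by positivity)]
        simp [ENNReal.ofReal_mul]

end Trace

end SplitTrace

/-! ### Assembly -/

open SplitTrace
theorem proposition3p2 (n : ℕ) :
    ∃ γ : ℝ, 0 < γ ∧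
      ∀ (Ω : Domain n) (W : WhitneyCovering Ω)
        (a : W.cubes → Fin n → ℝ) (ha : ∀ Q : W.cubes, Ω.IsNearest Q.1.center (a Q))
        (f : Ω.SplitBoundary → ℝ), Continuous f →
        ∀ (η : ℝ), 0 < η → ∀ g : W.cubes → Fin n → ℝ,
          (∀ Q Q' : W.cubes, (Q.1.toSet ∩ Q'.1.toSet).Nonempty →
            |f (W.omega Q (ha Q)) - f (W.omega Q' (ha Q')) - g Q' ⬝ᵥ (a Q - a Q')|
                ≤ η * (Q.1.diam + Q'.1.diam) ^ 2 ∧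
              ‖g Q - g Q'‖ ≤ η * (Q.1.diam + Q'.1.diam)) →
          ∃ F : (Fin n → ℝ) → ℝ, MemC2 Ω F ∧
            c2Seminorm Ω F ≤ ENNReal.ofReal (γ * η) ∧ IsTrace Ω F f := by
  obtain ⟨C, hC, H⟩ := WhitneyCovering.exists_glue_bounds n
  -- At most `n * n` second derivatives enter the seminorm; `+ 1` keeps the constant positive when
  -- `n = 0`.
  refine ⟨n * n * C + 1, by positivity, fun Ω W a ha f hf η hη g hg => ?_⟩
  obtain ⟨F, hF⟩ := H Ω W a ha (fun Q => f (W.omega Q (ha Q))) g η hη hg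
  have hcube : ∀ x ∈ Ω.carrier, ContDiffAt ℝ 2 F x ∧
      ∀ i j, |partialDeriv i (partialDeriv j F) x| ≤ C * η := by
    intro x hx
    obtain ⟨Q, hQ⟩ := W.exists_mem hx
    exact ⟨(hF Q x hQ).1, (hF Q x hQ).2.2.2⟩
  have hsemi : c2Seminorm Ω F ≤ ENNReal.ofReal ((n * n * C + 1) * η) :=
    (c2Seminorm_le fun x hx => (hcube x hx).2).trans (ENNReal.ofReal_le_ofReal (by linarith))
  exact ⟨F, ⟨fun x hx => (hcube x hx).1.contDiffWithinAt, hsemi.trans_lt ENNReal.ofReal_lt_top⟩,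
    hsemi, WhitneyCovering.isTrace_of_bounds ha hf (mul_pos hC hη) hF⟩
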